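/- Let $T>0$, $n_0>0$, and let $X(t)$, $t\in\mathbb R$, be a measurable zero-mean stationary Gaussian process with continuous autocorrelation function $R_X(t_1,t_2)=\mathbb E[X(t_1)X(t_2)]$. Let $(\lambda_k,\phi_k)_k$ be the Mercer eigenpairs of $R_X$ on $[0,T]$, that is, $\lambda_k>0$, $$\lambda_k\phi_k(t_1)=\int_0^T R_X(t_1,t_2)\,\phi_k(t_2)\,dt_2\quad(t_1\in[0,T]),\qquad \int_0^T\phi_i(t)\phi_j(t)\,dt=\delta_{ij},$$ where the list is complete: all positive eigenvalues occur, with their multiplicities (the list is finite if $R_X$ has finite rank, and infinite otherwise). Let $X$ be transmitted over the additive white Gaussian noise channel $Y=X+N$, with $N$ white Gaussian noise of power spectral density $n_0/2$ independent of $X$. Since white noise has no values at single instants, $Y$ is observed through its integral $$Z(t)=\int_0^t Y(s)\,ds=\int_0^t X(s)\,ds+\sqrt{n_0/2}\;W(t),$$ where $W$ is a standard Wiener process independent of $X$. Define the finite-time mutual information (in nats) on the window $[0,T]$ by $$I(T)=\lim_{n\to\infty}\ \sup_{t_1,\dots,t_n\in[0,T]} I\big((X(t_1),\dots,X(t_n));(Z(t_1),\dots,Z(t_n))\big),$$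 where $I(U;V)$ is the mutual information of the random vectors $U,V$ (the Kullback--Leibler divergence of their joint law from the product of their laws). Then the limit exists, the series below converges, and $$I(T)=\frac12\sum_k\log\Big(1+\frac{\lambda_k}{n_0/2}\Big).$$ -/

import Mathlib

open MeasureTheory ProbabilityTheory Filter Topology
open scoped ENNReal NNReal

namespace FiniteTimeMI

noncomputable section

/-- The autocorrelation function `R_X(s, t) = E[X(s) X(t)]` of a real process. -/
def autocorr {Ω : Type*} [MeasurableSpace Ω] (P : Measure Ω) (X : ℝ → Ω → ℝ) (s t : ℝ) : ℝ :=
  ∫ ω, X s ω * X t ω ∂P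

/-- A zero-mean stationary Gaussian process on the time axis `ℝ`. (For a zero-mean Gaussian
process, shift invariance of the autocorrelation is shift invariance of all finite-dimensional
distributions.) -/
structure IsStationaryGaussian {Ω : Type*} [MeasurableSpace Ω] (P : Measure Ω)
    (X : ℝ → Ω → ℝ) : Prop where
  gaussian : IsGaussianProcess X P
  zero_mean : ∀ t, ∫ ω, X t ω ∂P = 0
  stationary : ∀ s t h, autocorr P X (s + h) (t + h) = autocorr P X s t

/-- Shannon mutual information (in nats) of two random variables: the Kullback-Leibler divergence
of the joint law from the product of the marginal laws. -/
def mutualInfo {Ω E F : Type*} [MeasurableSpace Ω] [MeasurableSpace E] [MeasurableSpace F]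
    (P : Measure Ω) (U : Ω → E) (V : Ω → F) : ℝ≥0∞ :=
  InformationTheory.klDiv (P.map fun ω => (U ω, V ω)) ((P.map U).prod (P.map V))

/-- The mutual information of the samples of two processes at the instants `t 0, …, t (n - 1)`. -/
def sampleMutualInfo {Ω : Type*} [MeasurableSpace Ω] (P : Measure Ω) (X Y : ℝ → Ω → ℝ)
    {n : ℕ} (t : Fin n → ℝ) : ℝ≥0∞ :=
  mutualInfo P (fun ω i => X (t i) ω) (fun ω i => Y (t i) ω)

/-- `I` is the finite-time mutual information of `X` and `Y` on the window `[0, T]`: the limit,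
as `n → ∞`, of the supremum over `n` sampling points in `[0, T]` of the sample mutual
information. -/
def IsFiniteTimeMutualInfo {Ω : Type*} [MeasurableSpace Ω] (P : Measure Ω) (X Y : ℝ → Ω → ℝ)
    (T : ℝ) (I : ℝ≥0∞) : Prop :=
  Tendsto (fun n : ℕ => ⨆ t : Fin n → Set.Icc (0 : ℝ) T,
    sampleMutualInfo P X Y (fun i => (t i : ℝ))) atTop (𝓝 I)

/-- The received signal of the additive white Gaussian noise channel of noise power spectral
density `n₀ / 2`, in cumulative form. White noise `N` has no values at single instants; it is the
generalized process whose integral `∫₀ᵗ N(s) ds` is `√(n₀ / 2) W(t)` with `W` a standard Wiener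
process. So `Y = X + N` is observed through `∫₀ᵗ Y(s) ds = ∫₀ᵗ X(s) ds + √(n₀ / 2) W(t)`. -/
def awgnOutput {Ω : Type*} (n₀ : ℝ) (X : ℝ → Ω → ℝ) (W : ℝ≥0 → Ω → ℝ) (t : ℝ) (ω : Ω) : ℝ :=
  (∫ s in (0 : ℝ)..t, X s ω) + √(n₀ / 2) * W t.toNNReal ω

/-- The Mercer eigenpairs of a kernel `R` on `[0, T]`: an orthonormal family of eigenfunctions
`φ k` in `L²([0, T])` of the integral operator with kernel `R`, with eigenvalues `ev k > 0`, that
lists all positive eigenvalues with their multiplicities: an eigenfunction for a positive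
eigenvalue that is orthogonal to all `φ k` vanishes. The index set is arbitrary, since it is
finite for a degenerate kernel and countably infinite otherwise. -/
structure IsMercerSystem {ι : Type*} (R : ℝ → ℝ → ℝ) (T : ℝ) (ev : ι → ℝ) (φ : ι → ℝ → ℝ) :
    Prop where
  pos : ∀ k, 0 < ev k
  memLp : ∀ k, MemLp (φ k) 2 (volume.restrict (Set.Icc 0 T))
  eigen : ∀ k, ∀ t ∈ Set.Icc 0 T, ev k * φ k t = ∫ s in (0 : ℝ)..T, R t s * φ k s
  norm_one : ∀ k, ∫ t in (0 : ℝ)..T, φ k t * φ k t = 1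
  orthogonal : ∀ j k, j ≠ k → ∫ t in (0 : ℝ)..T, φ j t * φ k t = 0
  complete : ∀ (μ : ℝ) (ψ : ℝ → ℝ), 0 < μ → MemLp ψ 2 (volume.restrict (Set.Icc 0 T)) →
    (∀ t ∈ Set.Icc 0 T, μ * ψ t = ∫ s in (0 : ℝ)..T, R t s * ψ s) →
    (∀ k, ∫ t in (0 : ℝ)..T, φ k t * ψ t = 0) → ∀ t ∈ Set.Icc 0 T, ψ t = 0

end

end FiniteTimeMI

/-!
The signal `X` is viewed as a continuous curve in the Hilbert space `L²(P)`. Integration against it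
is a compact operator `A` from `L²([0, T])` to `L²(P)` (`processOp`), and `A† A` is the integral
operator with kernel the autocorrelation, so that the Mercer pairs are the nonzero spectrum of
`A† A`: `‖A u‖² = ∑ k, λ k * ⟪φ k, u⟫²` (`hasSum_mercer`). The operator is Hilbert-Schmidt, so the
eigenvalues are summable, and with them the logarithms.

The output at time `t` is `A 1_[0, t]` plus a noise variable, and the Gram matrix of the noise
variables is `n₀ / 2` times that of the indicators `1_[0, t]` in `L²([0, T])`. So the outputs at
finitely many instants are linearly equivalent to the outputs of parallel Gaussian channels with
orthogonal inputs `A (u j)`, of variances `μ j`, and white noise of variance `n₀ / 2`, where `u` is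
an orthonormal basis of the span of the indicators, chosen to diagonalize `‖A v‖²`
(`exists_whitening`, `exists_isParallelChannel`). The samples of `X` take part only as side
information.

For the upper bound the channel inputs are added to the samples of `X`. By data processing this can
only increase the information, which then is exactly `1 / 2 * ∑ j, log (1 + μ j / (n₀ / 2))`
(`IsParallelChannel.klDiv_eq`). As the `μ j` are the eigenvalues of a compression of `A† A`, the
concavity of the logarithm bounds this by the claimed series (`sum_log_compression_le`). The bound
holds for all samples (`sampleMutualInfo_le`).

For the lower bound the instants form a uniform grid. The Donsker-Varadhan inequality
(`ofReal_integral_le_klDiv`), with the log-likelihood ratio of a channel whose input is replaced by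
a linear estimate from the samples of `X`, gives the capacity of the parallel channels up to the
mean square error of the estimate (`IsParallelChannel.le_klDiv`). The estimate of `A (u j)`
integrates `u j` against the curve discretized on the grid. Then Bessel's inequality for
vector-valued functions bounds the total error, whatever the number of channels, by the squared
distance in `L²([0, T]; L²(P))` of the curve `X` to its discretization, which tends to zero because
the curve is continuous. The capacity itself
captures each eigenvalue `λ k` up to the squared distance of `φ k` to its own discretization
(`sum_mul_log_eigenvalue_le`, `one_sub_norm_sub_sq_le`), so in the limit any finite part of the
series is attained.
-/

namespace FiniteTimeMI

/-! ### Divergence bounds from an exponential test function -/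

section Divergence

open Real InformationTheory

variable {α : Type*} {mα : MeasurableSpace α} {μ ν : Measure α}

/-- The easy half of the Donsker–Varadhan variational formula. -/
lemma ofReal_integral_le_klDiv [IsProbabilityMeasure μ] [IsProbabilityMeasure ν] {g : α → ℝ}
    (hg : Integrable g μ) (hexp : Integrable (fun a => exp (g a)) ν)
    (hone : ∫ a, exp (g a) ∂ν = 1) :
    ENNReal.ofReal (∫ a, g a ∂μ) ≤ klDiv μ ν := by
  by_cases htop : klDiv μ ν = ∞
  · simp [htop]
  obtain ⟨hac, hint⟩ := klDiv_ne_top_iff.1 htop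
  have := isProbabilityMeasure_tilted hexp
  have hac' : μ ≪ ν.tilted g := hac.trans (absolutelyContinuous_tilted hexp)
  have hnn := integral_llr_add_sub_measure_univ_nonneg hac'
    (integrable_llr_tilted_right hac hg hint hexp)
  rw [integral_llr_tilted_right hac hg hexp hint, hone] at hnn
  rw [klDiv_of_ac_of_integrable hac hint]
  apply ENNReal.ofReal_le_ofReal
  simp at hnn ⊢
  linarith

/-- The case of equality in the Donsker–Varadhan variational formula: `g` is the log-density. -/
lemma klDiv_withDensity_exp [IsProbabilityMeasure μ] [IsProbabilityMeasure ν] {g : α → ℝ}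
    (hgm : Measurable g) (hg : Integrable g μ)
    (hμ : μ = ν.withDensity fun a => ENNReal.ofReal (exp (g a))) :
    klDiv μ ν = ENNReal.ofReal (∫ a, g a ∂μ) := by
  have hlint : ∫⁻ a, ENNReal.ofReal (exp (g a)) ∂ν = 1 := by
    have : μ Set.univ = 1 := measure_univ
    rwa [hμ, withDensity_apply _ .univ, Measure.restrict_univ] at this
  have hac : μ ≪ ν := hμ ▸ withDensity_absolutelyContinuous _ _
  have hllr : llr μ ν =ᵐ[μ] g := by
    apply hac.ae_le
    have : μ.rnDeriv ν =ᵐ[ν] fun a => ENNReal.ofReal (exp (g a)) := by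
      rw [hμ]
      exact Measure.rnDeriv_withDensity _ (by fun_prop)
    filter_upwards [this] with a ha
    rw [llr_def]
    simp only
    rw [ha, ENNReal.toReal_ofReal (exp_pos _).le, log_exp]
  rw [klDiv_of_ac_of_integrable hac ((integrable_congr hllr).2 hg), integral_congr_ae hllr]
  simp

end Divergence

/-! ### Densities of Gaussian product measures -/

section GaussianDensity

open Real

/-- A finite product of measures with densities has the product density. -/
lemma pi_withDensity {ι : Type*} [Fintype ι] (μ : ι → Measure ℝ) [∀ i, IsProbabilityMeasure (μ i)]
    (f : ι → ℝ → ℝ≥0∞) (hf : ∀ i, Measurable (f i))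
    [∀ i, SigmaFinite ((μ i).withDensity (f i))] :
    Measure.pi (fun i => (μ i).withDensity (f i)) =
      (Measure.pi μ).withDensity fun y => ∏ i, f i (y i) := by
  refine Measure.pi_eq fun s hs => ?_
  rw [withDensity_apply _ (MeasurableSet.univ_pi hs),
    ← lintegral_indicator (MeasurableSet.univ_pi hs)]
  have h1 : (Set.univ.pi s).indicator (fun y => ∏ i, f i (y i)) =
      fun y => ∏ i, (s i).indicator (f i) (y i) := by
    funext y
    by_cases hy : y ∈ Set.univ.pi s
    · rw [Set.indicator_of_mem hy]
      exact Finset.prod_congr rfl fun i _ => by rw [Set.indicator_of_mem (hy i trivial)]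
    · rw [Set.indicator_of_notMem hy]
      simp only [Set.mem_univ_pi, not_forall] at hy
      obtain ⟨i, hi⟩ := hy
      exact (Finset.prod_eq_zero (Finset.mem_univ i) (by rw [Set.indicator_of_notMem hi])).symm
  have hm : ∀ i, Measurable ((s i).indicator (f i)) := fun i => (hf i).indicator (hs i)
  have hind := iIndepFun_pi (μ := μ) (X := fun i => (s i).indicator (f i))
    (fun i => (hm i).aemeasurable)
  rw [h1]
  refine (lintegral_prod_eq_prod_lintegral_of_indepFun Finset.univ
    (fun i (y : ι → ℝ) => (s i).indicator (f i) (y i)) hind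
      (fun i => (hm i).comp (measurable_pi_apply i))).trans ?_
  refine Finset.prod_congr rfl fun i _ => ?_
  rw [withDensity_apply _ (hs i), ← lintegral_indicator (hs i)]
  exact (measurePreserving_eval μ i).lintegral_comp (hm i)

/-- The logarithm of the density of `N(a, s)` with respect to `N(0, v)`. -/
noncomputable def gaussianLogRatio (s v : ℝ≥0) (a y : ℝ) : ℝ :=
  log (v / s) / 2 - (y - a) ^ 2 / (2 * s) + y ^ 2 / (2 * v)

lemma gaussianReal_eq_withDensity {s v : ℝ≥0} (hs : s ≠ 0) (hv : v ≠ 0) (a : ℝ) :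
    gaussianReal a s =
      (gaussianReal 0 v).withDensity fun y => ENNReal.ofReal (exp (gaussianLogRatio s v a y)) := by
  have hs' : (0 : ℝ) < s := by positivity
  have hv' : (0 : ℝ) < v := by positivity
  rw [gaussianReal_of_var_ne_zero _ hs, gaussianReal_of_var_ne_zero _ hv,
    ← withDensity_mul _ (measurable_gaussianPDF _ _) (by unfold gaussianLogRatio; fun_prop)]
  congr 1
  funext y
  rw [Pi.mul_apply, gaussianPDF, gaussianPDF, ← ENNReal.ofReal_mul (gaussianPDFReal_nonneg _ _ _)]
  congr 1
  have hlog : exp (log (v / s) / 2) = √v / √s := by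
    rw [← sqrt_div hv'.le, sqrt_eq_rpow, rpow_def_of_pos (by positivity)]
    congr 1
    ring
  rw [gaussianPDFReal, gaussianPDFReal, gaussianLogRatio, exp_add, exp_sub, hlog,
    sqrt_mul (by positivity) (v : ℝ), sqrt_mul (by positivity) (s : ℝ), sub_zero, neg_div, neg_div,
    exp_neg, exp_neg]
  have h1 := (sqrt_pos.2 hs').ne'
  have h2 := (sqrt_pos.2 hv').ne'
  have h3 : √(2 * π) ≠ 0 := by positivity
  field_simp

variable {m : ℕ}

lemma measurable_sum_gaussianLogRatio (s : ℝ≥0) (v : Fin m → ℝ≥0) :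
    Measurable fun p : (Fin m → ℝ) × (Fin m → ℝ) =>
      ∑ j, gaussianLogRatio s (v j) (p.1 j) (p.2 j) := by
  unfold gaussianLogRatio
  fun_prop

lemma pi_gaussianReal_eq_withDensity {s : ℝ≥0} (hs : s ≠ 0) {v : Fin m → ℝ≥0} (hv : ∀ j, v j ≠ 0)
    (a : Fin m → ℝ) :
    Measure.pi (fun j => gaussianReal (a j) s) =
      (Measure.pi fun j => gaussianReal 0 (v j)).withDensity fun y =>
        ENNReal.ofReal (exp (∑ j, gaussianLogRatio s (v j) (a j) (y j))) := by
  have h : (fun j => gaussianReal (a j) s) = fun j => (gaussianReal 0 (v j)).withDensity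
      fun y => ENNReal.ofReal (exp (gaussianLogRatio s (v j) (a j) y)) :=
    funext fun j => gaussianReal_eq_withDensity hs (hv j) (a j)
  have hσ : ∀ j, SigmaFinite ((gaussianReal 0 (v j)).withDensity
      fun y => ENNReal.ofReal (exp (gaussianLogRatio s (v j) (a j) y))) := fun j => by
    rw [← gaussianReal_eq_withDensity hs (hv j) (a j)]; infer_instance
  rw [h, pi_withDensity]
  · congr 1
    funext y
    rw [exp_sum, ENNReal.ofReal_prod_of_nonneg fun _ _ => (exp_pos _).le]
  · intro j
    unfold gaussianLogRatio
    fun_prop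

lemma lintegral_exp_sum_gaussianLogRatio {s : ℝ≥0} (hs : s ≠ 0) {v : Fin m → ℝ≥0}
    (hv : ∀ j, v j ≠ 0) (a : Fin m → ℝ) :
    ∫⁻ y, ENNReal.ofReal (exp (∑ j, gaussianLogRatio s (v j) (a j) (y j)))
      ∂(Measure.pi fun j => gaussianReal 0 (v j)) = 1 := by
  have h : Measure.pi (fun j => gaussianReal (a j) s) Set.univ = 1 := measure_univ
  rwa [pi_gaussianReal_eq_withDensity hs hv, withDensity_apply _ .univ,
    Measure.restrict_univ] at h

end GaussianDensity

/-! ### Gaussian subspaces of `L²(P)` -/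

section GaussianSubspace

open Complex

variable {Ω : Type*} [MeasurableSpace Ω] {P : Measure Ω}

/-- A centred Gaussian subspace of `L²(P)`: every element `f` has law `N(0, ‖f‖²)`. -/
def IsGaussianSubspace (P : Measure Ω) (S : Submodule ℝ (Lp ℝ 2 P)) : Prop :=
  ∀ f ∈ S, P.map f = gaussianReal 0 (‖f‖₊ ^ 2)

lemma measurable_coeFn (f : Lp ℝ 2 P) : Measurable f := (Lp.stronglyMeasurable f).measurable

lemma inner_eq_integral_mul (f g : Lp ℝ 2 P) : inner ℝ f g = ∫ ω, f ω * g ω ∂P := by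
  rw [L2.inner_def]
  exact integral_congr_ae (ae_of_all _ fun ω => by simp [mul_comm])

lemma coeFn_sum_smul {κ : Type*} (s : Finset κ) (c : κ → ℝ) (f : κ → Lp ℝ 2 P) :
    ⇑(∑ k ∈ s, c k • f k) =ᵐ[P] fun ω => ∑ k ∈ s, c k * f k ω := by
  classical
  induction s using Finset.induction_on with
  | empty =>
    simp only [Finset.sum_empty]
    exact Lp.coeFn_zero ℝ 2 P
  | insert a s ha ih =>
    rw [Finset.sum_insert ha]
    filter_upwards [Lp.coeFn_add (c a • f a) (∑ k ∈ s, c k • f k), Lp.coeFn_smul (c a) (f a), ih]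
      with ω h1 h2 h3
    rw [h1, Pi.add_apply, h2, h3, Finset.sum_insert ha]
    simp

lemma integral_abs_le_norm [IsProbabilityMeasure P] (f : Lp ℝ 2 P) : ∫ ω, |f ω| ∂P ≤ ‖f‖ := by
  have h1 : eLpNorm f 1 P ≤ eLpNorm f 2 P :=
    eLpNorm_le_eLpNorm_of_exponent_le (by norm_num) (Lp.aestronglyMeasurable f)
  rw [Lp.norm_def]
  have h2 : ∫ ω, |f ω| ∂P = (eLpNorm f 1 P).toReal := by
    rw [eLpNorm_one_eq_lintegral_enorm, ← integral_norm_eq_lintegral_enorm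
      (Lp.aestronglyMeasurable f)]
    rfl
  rw [h2]
  exact ENNReal.toReal_mono (Lp.eLpNorm_ne_top f) h1

lemma norm_charFun_map_sub_le [IsProbabilityMeasure P] (f g : Lp ℝ 2 P) (t : ℝ) :
    ‖charFun (P.map f) t - charFun (P.map g) t‖ ≤ |t| * ‖f - g‖ := by
  have hf := measurable_coeFn f
  have hg := measurable_coeFn g
  have hint : ∀ h : Lp ℝ 2 P, Integrable (fun ω => exp (t * h ω * I)) P := fun h => by
    have hm := measurable_coeFn h
    refine Integrable.of_bound (by fun_prop) 1 (ae_of_all _ fun ω => ?_)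
    rw [← ofReal_mul, norm_exp_ofReal_mul_I]
  rw [charFun_apply_real, charFun_apply_real, integral_map hf.aemeasurable (by fun_prop),
    integral_map hg.aemeasurable (by fun_prop), ← integral_sub (hint f) (hint g)]
  refine (norm_integral_le_integral_norm _).trans ?_
  refine le_trans ?_ (mul_le_mul_of_nonneg_left (integral_abs_le_norm (f - g)) (abs_nonneg t))
  rw [← integral_const_mul]
  refine integral_mono_ae ((hint f).sub (hint g)).norm
    (((Lp.memLp (f - g)).integrable (by norm_num)).abs.const_mul _) ?_
  filter_upwards [Lp.coeFn_sub f g] with ω hω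
  rw [hω, Pi.sub_apply, ← abs_mul]
  have : exp (t * f ω * I) - exp (t * g ω * I) =
      exp ((t * g ω : ℝ) * I) * (exp (I * ((t * (f ω - g ω) : ℝ) : ℂ)) - 1) := by
    rw [mul_sub, ← exp_add, mul_one]
    push_cast
    ring_nf
  rw [this, norm_mul, norm_exp_ofReal_mul_I, one_mul]
  exact Real.norm_exp_I_mul_ofReal_sub_one_le

/-- Gaussianity passes to `L²` limits, by continuity of the characteristic function. -/
lemma IsGaussianSubspace.topologicalClosure [IsProbabilityMeasure P] {S : Submodule ℝ (Lp ℝ 2 P)}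
    (hS : IsGaussianSubspace P S) : IsGaussianSubspace P S.topologicalClosure := by
  intro f hf
  have : IsProbabilityMeasure (P.map f) :=
    Measure.isProbabilityMeasure_map (measurable_coeFn f).aemeasurable
  refine Measure.ext_of_charFun (funext fun t => ?_)
  have h1 : Continuous fun f : Lp ℝ 2 P => charFun (P.map f) t := by
    refine (LipschitzWith.of_dist_le_mul (K := ‖t‖₊) fun f g => ?_).continuous
    rw [dist_eq_norm, dist_eq_norm]
    exact norm_charFun_map_sub_le f g t
  have h2 : Continuous fun f : Lp ℝ 2 P => charFun (gaussianReal 0 (‖f‖₊ ^ 2)) t := by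
    simp only [charFun_gaussianReal]
    push_cast
    fun_prop
  have hcl : IsClosed {f : Lp ℝ 2 P | charFun (P.map f) t =
      charFun (gaussianReal 0 (‖f‖₊ ^ 2)) t} := isClosed_eq h1 h2
  refine closure_minimal (fun g hg => ?_) hcl hf
  simp only [Set.mem_ofPred_eq, hS g hg]

lemma map_eq_gaussianReal_of_hasGaussianLaw {f : Lp ℝ 2 P} (hf : HasGaussianLaw f P)
    (h0 : ∫ ω, f ω ∂P = 0) : P.map f = gaussianReal 0 (‖f‖₊ ^ 2) := by
  rw [hf.map_eq_gaussianReal, h0]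
  congr 1
  rw [variance_of_integral_eq_zero (measurable_coeFn f).aemeasurable h0]
  have : ∫ ω, f ω ^ 2 ∂P = ‖f‖ ^ 2 := by
    rw [← real_inner_self_eq_norm_sq, inner_eq_integral_mul]
    simp only [pow_two]
  apply NNReal.eq
  rw [Real.coe_toNNReal _ (integral_nonneg fun ω => sq_nonneg _)]
  simpa using this

/-- The span of a centred Gaussian process is a Gaussian subspace. -/
lemma isGaussianSubspace_span {τ : Type*} {Z : τ → Ω → ℝ} (hZ : IsGaussianProcess Z P)
    (h0 : ∀ t, ∫ ω, Z t ω ∂P = 0) {z : τ → Lp ℝ 2 P} (hz : ∀ t, z t =ᵐ[P] Z t) :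
    IsGaussianSubspace P (Submodule.span ℝ (Set.range z)) := by
  intro f hf
  obtain ⟨c, rfl⟩ := (Finsupp.mem_span_range_iff_exists_finsupp).1 hf
  have hae : ⇑(c.sum fun i a => a • z i) =ᵐ[P] fun ω => ∑ i ∈ c.support, c i * Z i ω := by
    have h2 : ∀ᵐ ω ∂P, ∀ i ∈ c.support, z i ω = Z i ω :=
      (Finset.eventually_all _).2 fun i _ => hz i
    filter_upwards [coeFn_sum_smul c.support c z, h2] with ω h h2
    rw [Finsupp.sum, h]
    exact Finset.sum_congr rfl fun i hi => by rw [h2 i hi]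
  have hlaw : HasGaussianLaw (fun ω => ∑ i ∈ c.support, c i * Z i ω) P := by
    let L : (c.support → ℝ) →L[ℝ] ℝ :=
      ∑ i : c.support, c i • ContinuousLinearMap.proj (R := ℝ) (φ := fun _ : c.support => ℝ) i
    have h := (hZ.hasGaussianLaw c.support).map_of_measurable L (by fun_prop)
    refine h.congr (ae_of_all _ fun ω => ?_)
    simp only [L, Function.comp_apply, _root_.sum_apply, _root_.smul_apply,
      ContinuousLinearMap.proj_apply, Finset.restrict, smul_eq_mul]
    exact Finset.sum_coe_sort c.support (fun i => c i * Z i ω)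
  refine map_eq_gaussianReal_of_hasGaussianLaw (hlaw.congr hae.symm) ?_
  rw [integral_congr_ae hae, integral_finsetSum _ fun i _ =>
    ((hZ.hasGaussianLaw_eval i).integrable).const_mul _]
  refine Finset.sum_eq_zero fun i _ => ?_
  rw [integral_const_mul, h0, mul_zero]

variable {S : Submodule ℝ (Lp ℝ 2 P)} {κ : Type*}

lemma IsGaussianSubspace.integral_eq_zero (hS : IsGaussianSubspace P S) {f : Lp ℝ 2 P}
    (hf : f ∈ S) : ∫ ω, f ω ∂P = 0 := by
  have h := integral_map (μ := P) (measurable_coeFn f).aemeasurable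
    (f := fun x : ℝ => x) (by fun_prop)
  rw [← h, hS f hf]
  exact integral_id_gaussianReal

lemma IsGaussianSubspace.covariance_eq_inner [IsProbabilityMeasure P]
    (hS : IsGaussianSubspace P S) {f g : Lp ℝ 2 P}
    (hf : f ∈ S) : cov[f, g; P] = inner ℝ f g := by
  rw [covariance_eq_sub (Lp.memLp f) (Lp.memLp g), hS.integral_eq_zero hf, inner_eq_integral_mul]
  simp

/-- Elements of a Gaussian subspace are jointly Gaussian. -/
lemma IsGaussianSubspace.hasGaussianLaw [Fintype κ] (hS : IsGaussianSubspace P S)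
    {f : κ → Lp ℝ 2 P} (hf : ∀ k, f k ∈ S) : HasGaussianLaw (fun ω k => f k ω) P where
  isGaussian_map := by
    classical
    have hm : Measurable fun ω k => f k ω := measurable_pi_lambda _ fun k => measurable_coeFn (f k)
    refine isGaussian_of_map_eq_gaussianReal fun L =>
      ⟨0, ‖∑ k, L (Pi.single k 1) • f k‖₊ ^ 2, ?_⟩
    rw [Measure.map_map (by fun_prop) hm,
      ← hS _ (S.sum_mem fun k _ => S.smul_mem (L (Pi.single k 1)) (hf k))]
    refine Measure.map_congr ?_
    filter_upwards [coeFn_sum_smul Finset.univ (fun k => L (Pi.single k 1)) f] with ω hω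
    rw [hω, Function.comp_apply, ← L.coe_coe, LinearMap.pi_apply_eq_sum_univ]
    refine Finset.sum_congr rfl fun k _ => ?_
    rw [smul_eq_mul, mul_comm, L.coe_coe]
    congr 2
    funext i
    simp [Pi.single_apply, eq_comm]

lemma IsGaussianSubspace.indepFun [IsProbabilityMeasure P] [Fintype κ] {m : ℕ}
    (hS : IsGaussianSubspace P S)
    {f : κ → Lp ℝ 2 P} {g : Fin m → Lp ℝ 2 P} (hf : ∀ k, f k ∈ S) (hg : ∀ j, g j ∈ S)
    (h : ∀ k j, inner ℝ (f k) (g j) = 0) :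
    IndepFun (fun ω k => f k ω) (fun ω j => g j ω) P := by
  refine HasGaussianLaw.indepFun_of_covariance_eval ?_ fun k j => ?_
  · have hjoint := hS.hasGaussianLaw (f := Sum.elim f g) (by rintro (k | j) <;> simp [hf, hg])
    let L : (κ ⊕ Fin m → ℝ) →L[ℝ] (κ → ℝ) × (Fin m → ℝ) :=
      { toFun x := (fun k => x (.inl k), fun j => x (.inr j))
        map_add' x y := by ext <;> simp
        map_smul' c x := by ext <;> simp }
    exact hjoint.map_of_measurable L (by fun_prop)
  · rw [hS.covariance_eq_inner (hf k), h]

lemma IsGaussianSubspace.map_eq_pi [IsProbabilityMeasure P] {m : ℕ} (hS : IsGaussianSubspace P S)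
    {g : Fin m → Lp ℝ 2 P} (hg : ∀ j, g j ∈ S) (h : ∀ i j, i ≠ j → inner ℝ (g i) (g j) = 0) :
    P.map (fun ω j => g j ω) = Measure.pi fun j => gaussianReal 0 (‖g j‖₊ ^ 2) := by
  have hind : iIndepFun (fun j => (g j : Ω → ℝ)) P :=
    (hS.hasGaussianLaw hg).iIndepFun_of_covariance_eq_zero fun i j hij => by
      rw [hS.covariance_eq_inner (hg i), h i j hij]
  rw [(iIndepFun_iff_map_fun_eq_pi_map fun j => (measurable_coeFn (g j)).aemeasurable).1 hind]
  congr 1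
  funext j
  exact hS _ (hg j)

end GaussianSubspace

/-! ### Mutual information across a Gaussian channel -/

section Channel

open Real InformationTheory

variable {Ω : Type*} [MeasurableSpace Ω] {P : Measure Ω} {κ : Type*} {m : ℕ}

/-- A family of parallel additive Gaussian channels with input variables `s j`, noise variables
`N j` of variance `σ2`, and side information `U`, all in the Gaussian subspace `S`. The inputs are
orthogonal with variances `μ j`, and the noise is independent of the inputs and of `U`. -/
structure IsParallelChannel (S : Submodule ℝ (Lp ℝ 2 P)) (U : κ → Lp ℝ 2 P)
    (s N : Fin m → Lp ℝ 2 P) (μ : Fin m → ℝ≥0) (σ2 : ℝ≥0) : Prop where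
  gaussian : IsGaussianSubspace P S
  mem_side : ∀ k, U k ∈ S
  mem_input : ∀ j, s j ∈ S
  mem_noise : ∀ j, N j ∈ S
  noise_pos : σ2 ≠ 0
  inner_side_noise : ∀ k j, inner ℝ (U k) (N j) = 0
  inner_input_noise : ∀ i j, inner ℝ (s i) (N j) = 0
  inner_input : ∀ i j, inner ℝ (s i) (s j) = if i = j then (μ i : ℝ) else 0
  inner_noise : ∀ i j, inner ℝ (N i) (N j) = if i = j then (σ2 : ℝ) else 0

namespace IsParallelChannel

variable {S : Submodule ℝ (Lp ℝ 2 P)} {U : κ → Lp ℝ 2 P}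
  {s N : Fin m → Lp ℝ 2 P} {μ : Fin m → ℝ≥0} {σ2 : ℝ≥0}

lemma inner_output (h : IsParallelChannel S U s N μ σ2) (i j : Fin m) :
    inner ℝ (s i + N i) (s j + N j) = if i = j then ((μ i + σ2 : ℝ≥0) : ℝ) else 0 := by
  rw [inner_add_left, inner_add_right, inner_add_right, h.inner_input, h.inner_noise,
    h.inner_input_noise, real_inner_comm, h.inner_input_noise]
  split_ifs <;> simp

lemma nnnorm_noise_sq (h : IsParallelChannel S U s N μ σ2) (j : Fin m) : ‖N j‖₊ ^ 2 = σ2 := by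
  apply NNReal.eq
  push_cast
  rw [← real_inner_self_eq_norm_sq, h.inner_noise, if_pos rfl]

lemma norm_output_sq (h : IsParallelChannel S U s N μ σ2) (j : Fin m) :
    ‖s j + N j‖ ^ 2 = (μ j + σ2 : ℝ≥0) := by
  rw [← real_inner_self_eq_norm_sq, h.inner_output, if_pos rfl]

lemma map_noise [IsProbabilityMeasure P] (h : IsParallelChannel S U s N μ σ2) :
    P.map (fun ω j => N j ω) = Measure.pi fun _ => gaussianReal 0 σ2 := by
  rw [h.gaussian.map_eq_pi h.mem_noise fun i j hij => by rw [h.inner_noise, if_neg hij]]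
  simp only [h.nnnorm_noise_sq]

lemma map_output [IsProbabilityMeasure P] (h : IsParallelChannel S U s N μ σ2) :
    P.map (fun ω j => (s j + N j) ω) = Measure.pi fun j => gaussianReal 0 (μ j + σ2) := by
  rw [h.gaussian.map_eq_pi (fun j => S.add_mem (h.mem_input j) (h.mem_noise j))
    fun i j hij => by rw [h.inner_output, if_neg hij]]
  congr 1
  funext j
  congr 1
  apply NNReal.eq
  simpa using h.norm_output_sq j

lemma measurable_side_output :
    Measurable fun ω => ((fun k => U k ω : κ → ℝ), (fun j => (s j + N j) ω : Fin m → ℝ)) :=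
  (measurable_pi_lambda _ fun k => measurable_coeFn (U k)).prodMk
    (measurable_pi_lambda _ fun j => measurable_coeFn (s j + N j))

variable [Fintype κ]

/-- The log-likelihood ratio of the output `p.2` given side information `p.1`, when the input is
estimated by the linear function of the side information with coefficients `α`. -/
noncomputable def logRatio (μ : Fin m → ℝ≥0) (σ2 : ℝ≥0) (α : Fin m → κ → ℝ)
    (p : (κ → ℝ) × (Fin m → ℝ)) : ℝ :=
  ∑ j, gaussianLogRatio σ2 (μ j + σ2) (∑ k, α j k * p.1 k) (p.2 j)

lemma measurable_logRatio (μ : Fin m → ℝ≥0) (σ2 : ℝ≥0) (α : Fin m → κ → ℝ) :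
    Measurable (logRatio μ σ2 α) := by
  have h := (measurable_sum_gaussianLogRatio σ2 fun j => μ j + σ2).comp
    (f := fun p : (κ → ℝ) × (Fin m → ℝ) => ((fun j => ∑ k, α j k * p.1 k), p.2)) (by fun_prop)
  exact h

lemma logRatio_ae_eq (α : Fin m → κ → ℝ) :
    (fun ω => logRatio μ σ2 α ((fun k => U k ω), fun j => (s j + N j) ω)) =ᵐ[P]
      fun ω => ∑ j, (log ((μ j + σ2 : ℝ≥0) / σ2) / 2
        - (s j + N j - ∑ k, α j k • U k : Lp ℝ 2 P) ω ^ 2 / (2 * σ2)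
        + (s j + N j) ω ^ 2 / (2 * (μ j + σ2 : ℝ≥0))) := by
  have h1 : ∀ᵐ ω ∂P, ∀ j, (∑ k, α j k • U k : Lp ℝ 2 P) ω = ∑ k, α j k * U k ω :=
    ae_all_iff.2 fun j => coeFn_sum_smul Finset.univ (α j) U
  have h2 : ∀ᵐ ω ∂P, ∀ j, (s j + N j - ∑ k, α j k • U k : Lp ℝ 2 P) ω =
      (s j + N j) ω - (∑ k, α j k • U k : Lp ℝ 2 P) ω :=
    ae_all_iff.2 fun j => Lp.coeFn_sub _ _
  filter_upwards [h1, h2] with ω h1 h2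
  refine Finset.sum_congr rfl fun j _ => ?_
  rw [h2, h1]
  rfl

lemma integrable_logRatio [IsProbabilityMeasure P] (α : Fin m → κ → ℝ) :
    Integrable (fun ω => logRatio μ σ2 α ((fun k => U k ω), fun j => (s j + N j) ω)) P := by
  rw [integrable_congr (logRatio_ae_eq α)]
  exact integrable_finsetSum _ fun j _ => ((integrable_const _).sub
    ((Lp.memLp (s j + N j - ∑ k, α j k • U k)).integrable_sq.div_const _)).add
    ((Lp.memLp (s j + N j)).integrable_sq.div_const _)

lemma integral_logRatio [IsProbabilityMeasure P] (h : IsParallelChannel S U s N μ σ2)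
    (α : Fin m → κ → ℝ) :
    ∫ ω, logRatio μ σ2 α ((fun k => U k ω), fun j => (s j + N j) ω) ∂P =
      1 / 2 * ∑ j, log (1 + μ j / σ2) - (∑ j, ‖s j - ∑ k, α j k • U k‖ ^ 2) / (2 * σ2) := by
  have hσ : (0 : ℝ) < σ2 := by have := h.noise_pos; positivity
  have hsq : ∀ f : Lp ℝ 2 P, ∫ ω, f ω ^ 2 ∂P = ‖f‖ ^ 2 := fun f => by
    rw [← real_inner_self_eq_norm_sq, inner_eq_integral_mul]
    simp only [pow_two]
  have hi : ∀ j, Integrable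
      (fun ω => (s j + N j - ∑ k, α j k • U k : Lp ℝ 2 P) ω ^ 2 / (2 * σ2)) P :=
    fun j => (Lp.memLp (s j + N j - ∑ k, α j k • U k)).integrable_sq.div_const _
  have hi' : ∀ j, Integrable (fun ω => (s j + N j) ω ^ 2 / (2 * (μ j + σ2 : ℝ≥0))) P :=
    fun j => (Lp.memLp (s j + N j)).integrable_sq.div_const _
  have hi'' : ∀ j, Integrable (fun ω => log ((μ j + σ2 : ℝ≥0) / σ2) / 2
      - (s j + N j - ∑ k, α j k • U k : Lp ℝ 2 P) ω ^ 2 / (2 * σ2)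
      + (s j + N j) ω ^ 2 / (2 * (μ j + σ2 : ℝ≥0))) P :=
    fun j => ((integrable_const _).sub (hi j)).add (hi' j)
  rw [integral_congr_ae (logRatio_ae_eq α), integral_finsetSum _ fun j _ => hi'' j, Finset.mul_sum,
    Finset.sum_div,
    ← Finset.sum_sub_distrib]
  refine Finset.sum_congr rfl fun j _ => ?_
  have hi₀ : Integrable (fun ω => log ((μ j + σ2 : ℝ≥0) / σ2) / 2
      - (s j + N j - ∑ k, α j k • U k : Lp ℝ 2 P) ω ^ 2 / (2 * σ2)) P :=
    (integrable_const _).sub (hi j)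
  rw [integral_add hi₀ (hi' j), integral_sub (integrable_const _) (hi j),
    integral_div, integral_div,
    integral_div, hsq, hsq,
    h.norm_output_sq]
  have h1 : ‖s j + N j - ∑ k, α j k • U k‖ ^ 2 = ‖s j - ∑ k, α j k • U k‖ ^ 2 + σ2 := by
    have h0 : inner ℝ (s j - ∑ k, α j k • U k) (N j) = 0 := by
      rw [inner_sub_left, h.inner_input_noise, sum_inner, zero_sub, neg_eq_zero]
      exact Finset.sum_eq_zero fun k _ => by rw [real_inner_smul_left, h.inner_side_noise, mul_zero]
    rw [show s j + N j - ∑ k, α j k • U k = (s j - ∑ k, α j k • U k) + N j by abel,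
      norm_add_sq_real, h0, ← real_inner_self_eq_norm_sq (N j), h.inner_noise, if_pos rfl]
    ring
  have h2 : ((μ j + σ2 : ℝ≥0) : ℝ) / σ2 = 1 + μ j / σ2 := by
    push_cast
    field_simp
    ring
  have h3 : ((μ j + σ2 : ℝ≥0) : ℝ) ≠ 0 := by
    push_cast
    positivity
  rw [h1, h2]
  simp only [integral_const, probReal_univ, one_smul]
  field_simp
  ring

/-- Whatever linear estimate of the input from the side information is used, the information in the
output about the side information is at least the capacity formula minus the estimation error. -/
lemma le_klDiv [IsProbabilityMeasure P] (h : IsParallelChannel S U s N μ σ2) (α : Fin m → κ → ℝ) :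
    ENNReal.ofReal (1 / 2 * ∑ j, log (1 + μ j / σ2)
        - (∑ j, ‖s j - ∑ k, α j k • U k‖ ^ 2) / (2 * σ2)) ≤
      klDiv (P.map fun ω => ((fun k => U k ω : κ → ℝ), (fun j => (s j + N j) ω : Fin m → ℝ)))
        ((P.map fun ω k => U k ω).prod (P.map fun ω j => (s j + N j) ω)) := by
  have hpair := measurable_side_output (U := U) (s := s) (N := N)
  have hm := measurable_logRatio μ σ2 α
  have hU : Measurable fun ω k => U k ω := measurable_pi_lambda _ fun k => measurable_coeFn (U k)
  have hY : Measurable fun ω j => (s j + N j) ω :=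
    measurable_pi_lambda _ fun j => measurable_coeFn (s j + N j)
  have := Measure.isProbabilityMeasure_map (μ := P) hU.aemeasurable
  have := Measure.isProbabilityMeasure_map (μ := P) hY.aemeasurable
  have := Measure.isProbabilityMeasure_map (μ := P) hpair.aemeasurable
  have hlint : ∫⁻ p, ENNReal.ofReal (exp (logRatio μ σ2 α p))
      ∂((P.map fun ω k => U k ω).prod (P.map fun ω j => (s j + N j) ω)) = 1 := by
    rw [lintegral_prod _ (by fun_prop), h.map_output]
    have hone : ∀ x : κ → ℝ, ∫⁻ y, ENNReal.ofReal (exp (logRatio μ σ2 α (x, y)))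
        ∂(Measure.pi fun j => gaussianReal 0 (μ j + σ2)) = 1 := fun x => by
      simp only [logRatio]
      exact lintegral_exp_sum_gaussianLogRatio h.noise_pos (v := fun j => μ j + σ2)
        (fun j => by simp [h.noise_pos]) (fun j => ∑ k, α j k * x k)
    simp only [hone, lintegral_const, measure_univ, mul_one]
  have hexp : Integrable (fun p => exp (logRatio μ σ2 α p))
      ((P.map fun ω k => U k ω).prod (P.map fun ω j => (s j + N j) ω)) := by
    refine ⟨by fun_prop, ?_⟩
    rw [hasFiniteIntegral_iff_ofReal (ae_of_all _ fun p => (exp_pos _).le), hlint]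
    exact ENNReal.one_lt_top
  rw [← h.integral_logRatio α, ← integral_map hpair.aemeasurable hm.aestronglyMeasurable]
  refine ofReal_integral_le_klDiv ?_ hexp ?_
  · rw [integrable_map_measure hm.aestronglyMeasurable hpair.aemeasurable]
    exact integrable_logRatio α
  · rw [integral_eq_lintegral_of_nonneg_ae (ae_of_all _ fun p => (exp_pos _).le) (by fun_prop),
      hlint, ENNReal.toReal_one]

/-- The capacity formula: if the side information determines the input, the information in the
output is exactly `1 / 2 * ∑ j, log (1 + μ j / σ2)`. -/
lemma klDiv_eq [IsProbabilityMeasure P] (h : IsParallelChannel S U s N μ σ2) (α : Fin m → κ → ℝ)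
    (hα : ∀ j, s j = ∑ k, α j k • U k) :
    klDiv (P.map fun ω => ((fun k => U k ω : κ → ℝ), (fun j => (s j + N j) ω : Fin m → ℝ)))
        ((P.map fun ω k => U k ω).prod (P.map fun ω j => (s j + N j) ω)) =
      ENNReal.ofReal (1 / 2 * ∑ j, log (1 + μ j / σ2)) := by
  have hpair := measurable_side_output (U := U) (s := s) (N := N)
  have hm := measurable_logRatio μ σ2 α
  have hU : Measurable fun ω k => U k ω := measurable_pi_lambda _ fun k => measurable_coeFn (U k)
  have hN : Measurable fun ω j => N j ω := measurable_pi_lambda _ fun j => measurable_coeFn (N j)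
  have hY : Measurable fun ω j => (s j + N j) ω :=
    measurable_pi_lambda _ fun j => measurable_coeFn (s j + N j)
  have := Measure.isProbabilityMeasure_map (μ := P) hU.aemeasurable
  have := Measure.isProbabilityMeasure_map (μ := P) hY.aemeasurable
  have := Measure.isProbabilityMeasure_map (μ := P) hpair.aemeasurable
  have hint := h.integral_logRatio α
  simp only [← hα, sub_self, norm_zero] at hint
  have hint' : ∫ p, logRatio μ σ2 α p
      ∂(P.map fun ω => ((fun k => U k ω : κ → ℝ), (fun j => (s j + N j) ω : Fin m → ℝ))) =
      1 / 2 * ∑ j, log (1 + μ j / σ2) := by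
    rw [integral_map hpair.aemeasurable hm.aestronglyMeasurable, hint]
    simp
  rw [← hint']
  refine klDiv_withDensity_exp hm ?_ ?_
  · rw [integrable_map_measure hm.aestronglyMeasurable hpair.aemeasurable]
    exact integrable_logRatio α
  -- The joint law is the image of a product law under `(u, n) ↦ (u, a u + n)`.
  let a : (κ → ℝ) → (Fin m → ℝ) := fun u j => ∑ k, α j k * u k
  have ha : Measurable a := by fun_prop
  have hae : (fun ω => ((fun k => U k ω : κ → ℝ), (fun j => (s j + N j) ω : Fin m → ℝ))) =ᵐ[P]
      (fun p : (κ → ℝ) × (Fin m → ℝ) => (p.1, a p.1 + p.2)) ∘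
        fun ω => ((fun k => U k ω), fun j => N j ω) := by
    have h1 : ∀ᵐ ω ∂P, ∀ j, s j ω = ∑ k, α j k * U k ω := ae_all_iff.2 fun j => by
      rw [hα j]
      exact coeFn_sum_smul Finset.univ (α j) U
    have h2 : ∀ᵐ ω ∂P, ∀ j, (s j + N j) ω = s j ω + N j ω :=
      ae_all_iff.2 fun j => Lp.coeFn_add _ _
    filter_upwards [h1, h2] with ω h1 h2
    simp only [Function.comp_apply, Prod.mk.injEq, true_and]
    funext j
    rw [h2, h1]
    rfl
  have hprod := (indepFun_iff_map_prod_eq_prod_map_map hU.aemeasurable hN.aemeasurable).1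
    (h.gaussian.indepFun h.mem_side h.mem_noise h.inner_side_noise)
  have hshift : Measurable fun p : (κ → ℝ) × (Fin m → ℝ) => (p.1, a p.1 + p.2) := by fun_prop
  rw [Measure.map_congr hae, ← Measure.map_map hshift (hU.prodMk hN), hprod, h.map_noise,
    h.map_output]
  have hfib : ∀ u : κ → ℝ, (Measure.pi fun _ : Fin m => gaussianReal 0 σ2).map (fun n => a u + n) =
      (Measure.pi fun j => gaussianReal 0 (μ j + σ2)).withDensity
        fun y => ENNReal.ofReal (exp (logRatio μ σ2 α (u, y))) := fun u => by
    have hpi := Measure.pi_map_pi (μ := fun _ : Fin m => gaussianReal 0 σ2)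
      (f := fun j x => a u j + x) (fun j => by fun_prop)
    have hpi' : (Measure.pi fun _ : Fin m => gaussianReal 0 σ2).map (fun n => a u + n) =
        Measure.pi fun j => gaussianReal (a u j) σ2 := by
      refine hpi.trans ?_
      congr 1
      funext j
      rw [gaussianReal_map_const_add, zero_add]
    rw [hpi']
    simp only [logRatio]
    exact pi_gaussianReal_eq_withDensity h.noise_pos (v := fun j => μ j + σ2)
      (fun j => by simp [h.noise_pos]) (a u)
  ext B hB
  rw [Measure.map_apply hshift hB, Measure.prod_apply (hshift hB), withDensity_apply _ hB,
    ← lintegral_indicator hB, lintegral_prod _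
      ((Measurable.indicator (by fun_prop) hB).aemeasurable)]
  refine lintegral_congr fun u => ?_
  have hBu : MeasurableSet (Prod.mk u ⁻¹' B) := measurable_prodMk_left hB
  have h1 := Measure.map_apply (μ := Measure.pi fun _ : Fin m => gaussianReal 0 σ2)
    (f := fun n => a u + n) (by fun_prop) hBu
  rw [hfib, withDensity_apply _ hBu, ← lintegral_indicator hBu] at h1
  exact h1.symm

end IsParallelChannel

end Channel

/-! ### Compressions of a positive operator -/

section Compression

variable {H G : Type*} [NormedAddCommGroup H] [InnerProductSpace ℝ H]
  [NormedAddCommGroup G] [InnerProductSpace ℝ G]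

/-- A finite-dimensional subspace has an orthonormal basis that diagonalizes the quadratic form
`v ↦ ‖A v‖ ^ 2`. -/
lemma exists_orthonormalBasis_diagonal (V : Submodule ℝ H) [FiniteDimensional ℝ V] (A : H →ₗ[ℝ] G) :
    ∃ (b : OrthonormalBasis (Fin (Module.finrank ℝ V)) ℝ V) (μ : Fin (Module.finrank ℝ V) → ℝ≥0),
      ∀ i j, inner ℝ (A (b i)) (A (b j)) = if i = j then (μ i : ℝ) else 0 := by
  let W : Submodule ℝ G := V.map A
  let B : V →ₗ[ℝ] W := (A.submoduleMap V)
  let T : V →ₗ[ℝ] V := B.adjoint ∘ₗ B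
  have hT : T.IsSymmetric := fun x y => by
    simp only [T, LinearMap.comp_apply]
    rw [LinearMap.adjoint_inner_left, LinearMap.adjoint_inner_right]
  have key : ∀ i j, inner ℝ (A (hT.eigenvectorBasis rfl i)) (A (hT.eigenvectorBasis rfl j)) =
      if i = j then hT.eigenvalues rfl i else 0 := fun i j => by
    have h1 : inner ℝ (A (hT.eigenvectorBasis rfl i)) (A (hT.eigenvectorBasis rfl j)) =
        inner ℝ (T (hT.eigenvectorBasis rfl i)) (hT.eigenvectorBasis rfl j) := by
      simp only [T, LinearMap.comp_apply]
      rw [LinearMap.adjoint_inner_left]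
      rfl
    rw [h1, hT.apply_eigenvectorBasis, real_inner_smul_left,
      orthonormal_iff_ite.1 (hT.eigenvectorBasis rfl).orthonormal i j]
    split_ifs <;> simp
  have hnn : ∀ i, 0 ≤ hT.eigenvalues rfl i := fun i => by
    have h := key i i
    rw [if_pos rfl] at h
    exact h ▸ real_inner_self_nonneg
  exact ⟨hT.eigenvectorBasis rfl, fun i => ⟨_, hnn i⟩, key⟩

/-- A compact positive operator vanishes on an invariant closed subspace without eigenvectors for
positive eigenvalues. -/
lemma apply_eq_zero_of_invariant {K : H →L[ℝ] H} (hKc : IsCompactOperator K)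
    (hKs : K.IsSymmetric) (hKp : ∀ v, 0 ≤ inner ℝ v (K v)) {N : Submodule ℝ H} [CompleteSpace N]
    (hinv : ∀ v ∈ N, K v ∈ N) (heig : ∀ c : ℝ, 0 < c → ∀ v ∈ N, K v = c • v → v = 0)
    {v : H} (hv : v ∈ N) : K v = 0 := by
  have hKN0 : K.restrict hinv = 0 := by
    rw [← ContinuousLinearMap.eq_zero_of_forall_hasEigenvalue_eq_zero (hKc.restrict' hinv)
      (hKs.restrict_invariant hinv)]
    intro c hc
    obtain ⟨⟨v, hvN⟩, hv⟩ := hc.exists_hasEigenvector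
    have hv1 : K v = c • v := congrArg Subtype.val hv.apply_eq_smul
    have hv0 : v ≠ 0 := fun h => hv.2 (Subtype.ext h)
    have hAv := hKp v
    rw [hv1, real_inner_smul_right, real_inner_self_eq_norm_sq] at hAv
    have hc0 : 0 ≤ c := by
      by_contra hneg
      have : 0 < ‖v‖ ^ 2 := by positivity
      nlinarith
    rcases hc0.eq_or_lt with h | h
    · exact h.symm
    · exact absurd (heig c h v hvN hv1) hv0
  exact congrArg Subtype.val (DFunLike.congr_fun hKN0 ⟨v, hv⟩)

/-- If no eigenvector of `A† A` (`A` compact) for a positive eigenvalue is orthogonal to the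
eigenvectors `e`, then `A` vanishes on the orthogonal complement of `e`. -/
lemma apply_eq_zero_of_forall_inner_eq_zero [CompleteSpace H] [CompleteSpace G] {A : H →L[ℝ] G}
    (hA : IsCompactOperator A) {ι : Type*} {e : ι → H} {ev : ι → ℝ}
    (heig : ∀ k v, inner ℝ (A v) (A (e k)) = ev k * inner ℝ v (e k))
    (hcomp : ∀ (c : ℝ) (u : H), 0 < c → (∀ v, inner ℝ (A v) (A u) = c * inner ℝ v u) →
      (∀ k, inner ℝ (e k) u = 0) → u = 0) {v : H}
    (hv : ∀ k, inner ℝ (e k) v = 0) : A v = 0 := by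
  obtain ⟨K, hK⟩ : ∃ K : H →L[ℝ] H, K = A.adjoint ∘L A := ⟨_, rfl⟩
  have hKi : ∀ v w, inner ℝ v (K w) = inner ℝ (A v) (A w) := fun v w => by
    rw [hK, ContinuousLinearMap.comp_apply, ContinuousLinearMap.adjoint_inner_right]
  have hKc : IsCompactOperator K := hK ▸ hA.clm_comp A.adjoint
  have hKs : K.IsSymmetric := fun v w => by
    simp only [ContinuousLinearMap.coe_coe]
    rw [hKi, real_inner_comm, hKi, real_inner_comm]
  have hmemN : ∀ v, v ∈ (Submodule.span ℝ (Set.range e))ᗮ ↔ ∀ k, inner ℝ (e k) v = 0 := fun v => by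
    rw [Submodule.mem_orthogonal]
    refine ⟨fun h k => h _ (Submodule.subset_span ⟨k, rfl⟩), fun h w hw => ?_⟩
    induction hw using Submodule.span_induction with
    | mem x hx => obtain ⟨k, rfl⟩ := hx; exact h k
    | zero => exact inner_zero_left _
    | add x y _ _ hx hy => rw [inner_add_left, hx, hy, add_zero]
    | smul a x _ hx => rw [real_inner_smul_left, hx, mul_zero]
  have : CompleteSpace (Submodule.span ℝ (Set.range e))ᗮ :=
    (Submodule.isClosed_orthogonal _).completeSpace_coe
  have h1 : K v = 0 := by
    refine apply_eq_zero_of_invariant hKc hKs (fun v => ?_) (fun v hv => ?_)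
      (fun c hc v hv hcv => ?_)
      ((hmemN v).2 hv)
    · rw [hKi]
      exact real_inner_self_nonneg
    · rw [hmemN] at hv ⊢
      intro k
      rw [hKi, real_inner_comm, heig, real_inner_comm, hv k, mul_zero]
    · refine hcomp c v hc (fun w => ?_) ((hmemN v).1 hv)
      rw [← hKi, hcv, real_inner_smul_right]
  rw [← norm_eq_zero, ← sq_eq_zero_iff, ← real_inner_self_eq_norm_sq, ← hKi, h1, inner_zero_right]

/-- Spectral theorem for `A† A`, `A` compact: if `e` is an orthonormal family of eigenvectors that
no eigenvector for a positive eigenvalue is orthogonal to, then `‖A u‖ ^ 2` is the sum of the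
eigencomponents. -/
lemma hasSum_eigenvalue_mul_inner_sq [CompleteSpace H] [CompleteSpace G] {A : H →L[ℝ] G}
    (hA : IsCompactOperator A) {ι : Type*} {e : ι → H} (he : Orthonormal ℝ e) {ev : ι → ℝ}
    (heig : ∀ k v, inner ℝ (A v) (A (e k)) = ev k * inner ℝ v (e k))
    (hcomp : ∀ (c : ℝ) (u : H), 0 < c → (∀ v, inner ℝ (A v) (A u) = c * inner ℝ v u) →
      (∀ k, inner ℝ (e k) u = 0) → u = 0) (u : H) :
    HasSum (fun k => ev k * inner ℝ (e k) u ^ 2) (‖A u‖ ^ 2) := by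
  have hsummable : Summable fun k => (inner ℝ (e k) u : ℝ) • e k := by
    have h := he.orthogonalFamily.summable_iff_norm_sq_summable fun k => (inner ℝ (e k) u : ℝ)
    simp only [LinearIsometry.toSpanSingleton_apply] at h
    exact h.2 (he.inner_products_summable u)
  obtain ⟨p, hp⟩ := hsummable
  have hup : A (u - p) = 0 := by
    refine apply_eq_zero_of_forall_inner_eq_zero hA heig hcomp fun k => ?_
    have h1 := hp.mapL (innerSL ℝ (e k))
    have h2 : HasSum (fun l => innerSL ℝ (e k) ((inner ℝ (e l) u : ℝ) • e l))
        (inner ℝ (e k) u) := by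
      classical
      convert! hasSum_ite_eq k (inner ℝ (e k) u : ℝ) using 1
      funext l
      rw [innerSL_apply_apply, real_inner_smul_right, orthonormal_iff_ite.1 he k l]
      by_cases h : k = l
      · subst h; simp
      · simp [h, Ne.symm h]
    rw [inner_sub_right, sub_eq_zero]
    exact h2.unique h1
  have hAp : A u = A p := by rwa [map_sub, sub_eq_zero] at hup
  have h := hp.mapL ((innerSL ℝ (A u)).comp A)
  have hval : ((innerSL ℝ (A u)).comp A) p = ‖A u‖ ^ 2 := by
    rw [ContinuousLinearMap.comp_apply, innerSL_apply_apply, ← hAp, real_inner_self_eq_norm_sq]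
  rw [hval] at h
  convert! h using 1
  funext k
  rw [ContinuousLinearMap.comp_apply, innerSL_apply_apply, map_smul, real_inner_smul_right, heig,
    real_inner_comm]
  ring

lemma sum_mul_log_le {κ : Type*} {c : ℝ} (hc : 0 < c) (t : Finset κ) {p x : κ → ℝ}
    (hp : ∀ k ∈ t, 0 ≤ p k) (hp1 : ∑ k ∈ t, p k ≤ 1) (hx : ∀ k ∈ t, 0 ≤ x k) :
    ∑ k ∈ t, p k * Real.log (1 + x k / c) ≤ Real.log (1 + (∑ k ∈ t, p k * x k) / c) := by
  have h := strictConcaveOn_log_Ioi.concaveOn.map_add_sum_le (t := t) (w := p)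
    (p := fun k => 1 + x k / c) (q := 1) (v := 1 - ∑ k ∈ t, p k) hp (by ring)
    (fun k hk => by have := hx k hk; simp only [Set.mem_Ioi]; positivity) (by linarith) (by simp)
  simp only [smul_eq_mul, Real.log_one, mul_zero, zero_add, mul_one, mul_add,
    Finset.sum_add_distrib] at h
  refine h.trans_eq ?_
  rw [Finset.sum_div]
  congr 1
  simp only [mul_div_assoc]
  ring

/-- The compression of `A† A` to an orthonormal family has at most the log-determinant of `A† A`.
Writing `p j k = ev k * ⟪u j, e k⟫ ^ 2 / μ j`, the rows of `p` sum to one, the columns to at most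
one, and `∑ j, p j k * μ j ≤ ev k`, so that the claim follows from the concavity of the
logarithm. -/
lemma sum_log_compression_le {A : H →L[ℝ] G} {ι : Type*} {e : ι → H} (hnorm : ∀ k, ‖e k‖ = 1)
    {ev : ι → ℝ} (hev : ∀ k, 0 < ev k)
    (hspec : ∀ u, HasSum (fun k => ev k * inner ℝ (e k) u ^ 2) (‖A u‖ ^ 2))
    {c : ℝ} (hc : 0 < c) (hsum : Summable fun k => Real.log (1 + ev k / c))
    {m : ℕ} {u : Fin m → H} (hu : Orthonormal ℝ u) {μ : Fin m → ℝ≥0}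
    (hμ : ∀ i j, inner ℝ (A (u i)) (A (u j)) = if i = j then (μ i : ℝ) else 0) :
    ∑ j, Real.log (1 + μ j / c) ≤ ∑' k, Real.log (1 + ev k / c) := by
  have hrow : ∀ j, HasSum (fun k => ev k * inner ℝ (e k) (u j) ^ 2 / μ j * Real.log (1 + μ j / c))
      (Real.log (1 + μ j / c)) := fun j => by
    rcases eq_or_ne (μ j) 0 with h0 | h0
    · simp [h0]
    · have h := ((hspec (u j)).div_const (μ j : ℝ)).mul_right (Real.log (1 + μ j / c))
      rwa [← real_inner_self_eq_norm_sq, hμ, if_pos rfl, div_self (by exact_mod_cast h0),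
        one_mul] at h
  have htot := hasSum_sum fun j (_ : j ∈ Finset.univ) => hrow j
  refine hasSum_le (fun k => ?_) htot hsum.hasSum
  set a : Fin m → ℝ := fun j => inner ℝ (e k) (u j) with ha
  have hcol : ∑ j, ev k * a j ^ 2 / μ j ≤ 1 := by
    set S := ∑ j, a j ^ 2 / μ j with hS
    have hS0 : 0 ≤ S := Finset.sum_nonneg fun j _ => by positivity
    have hAv : ‖A (∑ j, (a j / μ j) • u j)‖ ^ 2 = S := by
      rw [← real_inner_self_eq_norm_sq, map_sum, sum_inner]
      refine Finset.sum_congr rfl fun i _ => ?_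
      rw [inner_sum, Finset.sum_eq_single i]
      · rw [map_smul, real_inner_smul_left, real_inner_smul_right, hμ, if_pos rfl]
        rcases eq_or_ne (μ i : ℝ) 0 with h0 | h0
        · simp [h0]
        · field_simp
      · intro j _ hj
        rw [map_smul, map_smul, real_inner_smul_left, real_inner_smul_right, hμ, if_neg hj.symm,
          mul_zero, mul_zero]
      · simp
    have hin : inner ℝ (e k) (∑ j, (a j / μ j) • u j) = S := by
      rw [inner_sum]
      refine Finset.sum_congr rfl fun j _ => ?_
      rw [real_inner_smul_right]
      change a j / μ j * a j = _
      ring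
    have hle := le_hasSum (hspec (∑ j, (a j / μ j) • u j)) k
      fun l _ => mul_nonneg (hev l).le (sq_nonneg _)
    rw [hAv, hin] at hle
    have hrw : ∑ j, ev k * a j ^ 2 / μ j = ev k * S := by
      rw [hS, Finset.mul_sum]
      exact Finset.sum_congr rfl fun j _ => by ring
    rw [hrw]
    rcases hS0.eq_or_lt with h | h
    · rw [← h, mul_zero]; exact zero_le_one
    · nlinarith
  have hmass : ∑ j, ev k * a j ^ 2 / μ j * μ j ≤ ev k := by
    have hB := hu.sum_inner_products_le (e k) (s := Finset.univ)
    rw [hnorm, one_pow] at hB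
    calc ∑ j, ev k * a j ^ 2 / μ j * μ j ≤ ∑ j, ev k * ‖(inner ℝ (u j) (e k) : ℝ)‖ ^ 2 := by
          refine Finset.sum_le_sum fun j _ => ?_
          rw [Real.norm_eq_abs, sq_abs, real_inner_comm]
          rcases eq_or_ne (μ j : ℝ) 0 with h0 | h0
          · rw [h0, mul_zero]
            exact mul_nonneg (hev k).le (sq_nonneg _)
          · rw [div_mul_cancel₀ _ h0]
      _ = ev k * ∑ j, ‖(inner ℝ (u j) (e k) : ℝ)‖ ^ 2 := by rw [Finset.mul_sum]
      _ ≤ ev k * 1 := mul_le_mul_of_nonneg_left hB (hev k).le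
      _ = ev k := mul_one _
  have hp : ∀ j ∈ Finset.univ, 0 ≤ ev k * a j ^ 2 / μ j := fun j _ => by
    have := hev k
    positivity
  refine (sum_mul_log_le hc Finset.univ hp hcol fun j _ => (μ j).2).trans ?_
  have hm0 : 0 ≤ ∑ j, ev k * a j ^ 2 / μ j * μ j :=
    Finset.sum_nonneg fun j hj => mul_nonneg (hp j hj) (μ j).2
  refine Real.log_le_log (by positivity) ?_
  gcongr
  exact hmass

/-- Conversely, the compression to an orthonormal family captures each eigenvalue up to the squared
length of the projection of its eigenvector. -/
lemma sum_mul_log_eigenvalue_le {A : H →L[ℝ] G} {ι : Type*} {e : ι → H} (he : Orthonormal ℝ e)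
    {ev : ι → ℝ} (hev : ∀ k, 0 < ev k)
    (hspec : ∀ u, HasSum (fun k => ev k * inner ℝ (e k) u ^ 2) (‖A u‖ ^ 2))
    {c : ℝ} (hc : 0 < c) (t : Finset ι)
    {m : ℕ} {u : Fin m → H} (hu : ∀ j, ‖u j‖ = 1) :
    ∑ k ∈ t, (∑ j, inner ℝ (e k) (u j) ^ 2) * Real.log (1 + ev k / c) ≤
      ∑ j, Real.log (1 + ‖A (u j)‖ ^ 2 / c) := by
  simp only [Finset.sum_mul]
  rw [Finset.sum_comm]
  refine Finset.sum_le_sum fun j _ => ?_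
  have hB := he.sum_inner_products_le (u j) (s := t)
  simp only [Real.norm_eq_abs, sq_abs, hu, one_pow] at hB
  refine (sum_mul_log_le hc t (fun k _ => sq_nonneg _) hB fun k _ => (hev k).le).trans ?_
  have h0 : 0 ≤ ∑ k ∈ t, inner ℝ (e k) (u j) ^ 2 * ev k :=
    Finset.sum_nonneg fun k _ => mul_nonneg (sq_nonneg _) (hev k).le
  refine Real.log_le_log (by positivity) ?_
  gcongr
  have h := sum_le_hasSum t (fun l _ => mul_nonneg (hev l).le (sq_nonneg _)) (hspec (u j))
  simpa only [mul_comm] using h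

lemma one_sub_norm_sub_sq_le {m : ℕ} {u : Fin m → H} (hu : Orthonormal ℝ u) {e : H}
    (he : ‖e‖ = 1) {v : H} (hv : v ∈ Submodule.span ℝ (Set.range u)) :
    1 - ‖e - v‖ ^ 2 ≤ ∑ j, inner ℝ e (u j) ^ 2 := by
  obtain ⟨β, rfl⟩ := (Submodule.mem_span_range_iff_exists_fun ℝ).1 hv
  have h1 : ‖∑ j, β j • u j‖ ^ 2 = ∑ j, β j ^ 2 := by
    rw [← real_inner_self_eq_norm_sq, hu.inner_sum]
    simp [pow_two]
  rw [norm_sub_sq_real, he, h1, inner_sum]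
  simp only [real_inner_smul_right]
  have h2 : 0 ≤ ∑ j, (β j - inner ℝ e (u j)) ^ 2 := Finset.sum_nonneg fun j _ => sq_nonneg _
  have h3 : ∑ j, (β j - inner ℝ e (u j)) ^ 2 =
      ∑ j, β j ^ 2 - 2 * ∑ j, β j * inner ℝ e (u j) + ∑ j, inner ℝ e (u j) ^ 2 := by
    rw [Finset.mul_sum, ← Finset.sum_sub_distrib, ← Finset.sum_add_distrib]
    exact Finset.sum_congr rfl fun j _ => by ring
  linarith

end Compression

/-! ### Integral operators with a square-integrable vector kernel -/

section KernelOperator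

variable {α G : Type*} [MeasurableSpace α] {μ : Measure α}
  [NormedAddCommGroup G] [InnerProductSpace ℝ G]

lemma integrable_smul_kernel (d : Lp G 2 μ) (u : Lp ℝ 2 μ) :
    Integrable (fun x => u x • d x) μ :=
  memLp_one_iff_integrable.1 ((Lp.memLp d).smul (Lp.memLp u))

variable [CompleteSpace G]

/-- The operator `u ↦ ∫ u • d` from `L²(μ)` to `G` with kernel `d ∈ L²(μ; G)`, as a continuous
linear function of `d`. -/
noncomputable def kernelOp : Lp G 2 μ →L[ℝ] Lp ℝ 2 μ →L[ℝ] G :=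
  ((ContinuousLinearMap.lsmul ℝ ℝ).lpPairing μ 2 2).flip

lemma kernelOp_apply (d : Lp G 2 μ) (u : Lp ℝ 2 μ) : kernelOp d u = ∫ x, u x • d x ∂μ := by
  rw [kernelOp, ContinuousLinearMap.flip_apply, ContinuousLinearMap.lpPairing_eq_integral]
  rfl

lemma inner_kernelOp (d : Lp G 2 μ) (u : Lp ℝ 2 μ) (c : G) :
    inner ℝ c (kernelOp d u) = ∫ x, u x * inner ℝ c (d x) ∂μ := by
  rw [kernelOp_apply, ← integral_inner (integrable_smul_kernel d u)]
  simp only [real_inner_smul_right]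

/-- Integral operators with a square-integrable kernel are compact: the kernel is an `L²` limit of
simple functions, which give operators of finite rank. -/
lemma isCompactOperator_kernelOp (d : Lp G 2 μ) : IsCompactOperator (kernelOp d) := by
  refine Lp.induction (p := 2) ENNReal.ofNat_ne_top (fun d => IsCompactOperator (kernelOp d))
    (fun c s hs hμs => ?_) (fun f g hf hg _ hf' hg' => ?_) ?_ d
  · have h : ⇑(kernelOp (Lp.simpleFunc.indicatorConst 2 hs hμs.ne c : Lp G 2 μ)) =
        ContinuousLinearMap.toSpanSingleton ℝ c ∘
          (kernelOp (indicatorConstLp 2 hs hμs.ne (1 : ℝ))) := funext fun u => by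
      rw [Function.comp_apply, kernelOp_apply, kernelOp_apply,
        ContinuousLinearMap.toSpanSingleton_apply, ← integral_smul_const,
        Lp.simpleFunc.coe_indicatorConst]
      refine integral_congr_ae ?_
      filter_upwards [indicatorConstLp_coeFn (p := 2) (hs := hs) (hμs := hμs.ne) (c := c),
        indicatorConstLp_coeFn (p := 2) (hs := hs) (hμs := hμs.ne) (c := (1 : ℝ))] with x h1 h2
      rw [h1, h2]
      by_cases hx : x ∈ s <;> simp [hx]
    have h2 : IsCompactOperator (kernelOp (indicatorConstLp 2 hs hμs.ne (1 : ℝ))) :=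
      isCompactOperator_of_locallyCompactSpace_dom _
    rw [h]
    exact h2.clm_comp (ContinuousLinearMap.toSpanSingleton ℝ c)
  · have : kernelOp (hf.toLp f + hg.toLp g) = kernelOp (hf.toLp f) + kernelOp (hg.toLp g) :=
      map_add _ _ _
    rw [this]
    exact hf'.add hg'
  · exact isClosed_setOfPred_isCompactOperator.preimage kernelOp.continuous

/-- Bessel's inequality for vector-valued coefficients. -/
lemma sum_norm_kernelOp_sq_le (d : Lp G 2 μ) {ι : Type*} {u : ι → Lp ℝ 2 μ} (hu : Orthonormal ℝ u)
    (t : Finset ι) : ∑ j ∈ t, ‖kernelOp d (u j)‖ ^ 2 ≤ ‖d‖ ^ 2 := by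
  classical
  let w : ι → Lp G 2 μ := fun j =>
    (ContinuousLinearMap.toSpanSingleton ℝ (kernelOp d (u j))).compLp (u j)
  have hw : ∀ j, w j =ᵐ[μ] fun x => u j x • kernelOp d (u j) := fun j =>
    ContinuousLinearMap.coeFn_compLp _ _
  have hwd : ∀ j, inner ℝ (w j) d = ‖kernelOp d (u j)‖ ^ 2 := fun j => by
    rw [L2.inner_def, ← real_inner_self_eq_norm_sq, inner_kernelOp]
    refine integral_congr_ae ?_
    filter_upwards [hw j] with x hx
    rw [hx, real_inner_smul_left]
  have hww : ∀ i j, inner ℝ (w i) (w j) =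
      (if i = j then 1 else 0) * inner ℝ (kernelOp d (u i)) (kernelOp d (u j)) := fun i j => by
    rw [← orthonormal_iff_ite.1 hu i j, L2.inner_def, L2.inner_def, ← integral_mul_const]
    refine integral_congr_ae ?_
    filter_upwards [hw i, hw j] with x hi hj
    rw [hi, hj, real_inner_smul_left, real_inner_smul_right]
    simp only [RCLike.inner_apply, conj_trivial]
    ring
  have hsum : ‖∑ j ∈ t, w j‖ ^ 2 = ∑ j ∈ t, ‖kernelOp d (u j)‖ ^ 2 := by
    rw [← real_inner_self_eq_norm_sq, sum_inner]
    refine Finset.sum_congr rfl fun i hi => ?_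
    rw [inner_sum, Finset.sum_eq_single_of_mem i hi]
    · rw [hww, if_pos rfl, one_mul, real_inner_self_eq_norm_sq]
    · intro j _ hj
      rw [hww, if_neg hj.symm, zero_mul]
  have h0 := sq_nonneg ‖d - ∑ j ∈ t, w j‖
  rw [norm_sub_sq_real, hsum, real_inner_comm, sum_inner] at h0
  simp only [hwd] at h0
  linarith

end KernelOperator

/-! ### Sampling a continuous path on a grid -/

section Sampling

/-- The window `[0, T]` with Lebesgue measure. -/
noncomputable abbrev window (T : ℝ) : Measure ℝ := volume.restrict (Set.Icc 0 T)

/-- The indicator of `[0, t]` as an element of `L²([0, T])`. -/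
noncomputable def initialIndicator (T t : ℝ) : Lp ℝ 2 (window T) :=
  indicatorConstLp 2 (measurableSet_Icc : MeasurableSet (Set.Icc 0 t)) (measure_ne_top _ _) 1

lemma initialIndicator_coeFn (T t : ℝ) :
    initialIndicator T t =ᵐ[window T] (Set.Icc 0 t).indicator fun _ => (1 : ℝ) :=
  indicatorConstLp_coeFn

lemma inner_initialIndicator {T s t : ℝ} (hs : s ∈ Set.Icc 0 T) (ht : t ∈ Set.Icc 0 T) :
    inner ℝ (initialIndicator T s) (initialIndicator T t) = min s t := by
  have h : inner ℝ (initialIndicator T s) (initialIndicator T t) =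
      (window T).real (Set.Icc 0 s ∩ Set.Icc 0 t) :=
    L2.inner_indicatorConstLp_one_indicatorConstLp_one ..
  rw [h, Set.Icc_inter_Icc, measureReal_restrict_apply measurableSet_Icc, Set.Icc_inter_Icc]
  have h2 : min (min s t) T = min s t := min_eq_left ((min_le_left _ _).trans hs.2)
  simp only [max_self, Real.volume_real_Icc, sub_zero]
  rw [h2, max_eq_left (le_min hs.1 ht.1)]

lemma initialIndicator_zero (T : ℝ) : initialIndicator T 0 = 0 := by
  rw [← norm_eq_zero, ← sq_eq_zero_iff, ← real_inner_self_eq_norm_sq]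
  have h : inner ℝ (initialIndicator T 0) (initialIndicator T 0) =
      (window T).real (Set.Icc 0 0 ∩ Set.Icc 0 0) :=
    L2.inner_indicatorConstLp_one_indicatorConstLp_one ..
  rw [h]
  simp [measureReal_def]

/-- The `i`-th point of the grid that cuts `[0, T]` into `n` intervals. -/
noncomputable def grid (T : ℝ) (n i : ℕ) : ℝ := i * T / n

/-- Rounding up to the next point of the grid with `n` intervals. -/
noncomputable def roundUp (T : ℝ) (n : ℕ) (s : ℝ) : ℝ := grid T n ⌈n * s / T⌉₊

lemma measurable_roundUp (T : ℝ) (n : ℕ) : Measurable (roundUp T n) := by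
  unfold roundUp grid
  exact ((measurable_from_nat.comp
    (Nat.measurable_ceil.comp (by fun_prop))).mul_const _).div_const _

variable {T : ℝ} {n : ℕ}

lemma grid_zero : grid T n 0 = 0 := by simp [grid]

lemma grid_mem (hT : 0 < T) {i : ℕ} (hi : i ≤ n) : grid T n i ∈ Set.Icc 0 T := by
  refine ⟨by unfold grid; positivity, ?_⟩
  rcases Nat.eq_zero_or_pos n with rfl | hn
  · simpa [grid] using hT.le
  · have : (i : ℝ) ≤ n := by exact_mod_cast hi
    rw [grid, div_le_iff₀ (by positivity), mul_comm]
    gcongr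

lemma roundUp_mem (hT : 0 < T) {s : ℝ} (hs : s ∈ Set.Icc 0 T) :
    roundUp T n s ∈ Set.Icc 0 T := by
  refine grid_mem hT (Nat.ceil_le.2 ?_)
  rw [div_le_iff₀ hT]
  gcongr
  exact hs.2

lemma le_roundUp (hT : 0 < T) (hn : 0 < n) (s : ℝ) : s ≤ roundUp T n s := by
  have h := Nat.le_ceil (n * s / T)
  have hn' : (0 : ℝ) < n := by exact_mod_cast hn
  rw [roundUp, grid, le_div_iff₀ hn']
  rw [div_le_iff₀ hT] at h
  linarith

lemma roundUp_le (hT : 0 < T) (hn : 0 < n) {s : ℝ} (hs : 0 ≤ s) : roundUp T n s ≤ s + T / n := by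
  have h := (Nat.ceil_lt_add_one (a := n * s / T) (by positivity)).le
  have hn' : (0 : ℝ) < n := by exact_mod_cast hn
  rw [roundUp, grid, div_le_iff₀ hn']
  calc (⌈n * s / T⌉₊ : ℝ) * T ≤ (n * s / T + 1) * T := by gcongr
    _ = (s + T / n) * n := by field_simp

lemma tendsto_roundUp (hT : 0 < T) {s : ℝ} (hs : 0 ≤ s) :
    Tendsto (fun n => roundUp T n s) atTop (𝓝 s) := by
  have h : Tendsto (fun n : ℕ => s + T / n) atTop (𝓝 s) := by
    simpa using (tendsto_const_div_atTop_nhds_zero_nat T).const_add s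
  refine tendsto_of_tendsto_of_tendsto_of_le_of_le' tendsto_const_nhds h ?_ ?_
  · filter_upwards [eventually_gt_atTop 0] with n hn using le_roundUp hT hn s
  · filter_upwards [eventually_gt_atTop 0] with n hn using roundUp_le hT hn hs

/-- A path rounded up to the grid is a step function with respect to the initial segments. -/
lemma comp_roundUp_eq_sum {E : Type*} [AddCommGroup E] [Module ℝ E] (hT : 0 < T) (hn : 0 < n)
    (f : ℝ → E) {s : ℝ} (hs : s ∈ Set.Ioc 0 T) :
    f (roundUp T n s) = ∑ i : Fin n,
      ((Set.Icc 0 (grid T n (i + 1))).indicator (fun _ => (1 : ℝ)) s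
        - (Set.Icc 0 (grid T n i)).indicator (fun _ => (1 : ℝ)) s) • f (grid T n (i + 1)) := by
  have hn' : (0 : ℝ) < n := by exact_mod_cast hn
  have hpos : 0 < ⌈n * s / T⌉₊ := Nat.ceil_pos.2 (by have := hs.1; positivity)
  have hle : ⌈n * s / T⌉₊ ≤ n := by
    refine Nat.ceil_le.2 ?_
    rw [div_le_iff₀ hT]
    gcongr
    exact hs.2
  have hmem : ∀ i : ℕ, s ∈ Set.Icc 0 (grid T n i) ↔ ⌈n * s / T⌉₊ ≤ i := fun i => by
    rw [Nat.ceil_le, div_le_iff₀ hT, grid, Set.mem_Icc, le_div_iff₀ hn', mul_comm s]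
    exact ⟨fun h => h.2, fun h => ⟨hs.1.le, h⟩⟩
  have hind : ∀ i : ℕ, (Set.Icc 0 (grid T n i)).indicator (fun _ => (1 : ℝ)) s =
      if ⌈n * s / T⌉₊ ≤ i then 1 else 0 := fun i => by
    rw [Set.indicator_apply]
    simp only [hmem]
  rw [Finset.sum_eq_single (⟨⌈n * s / T⌉₊ - 1, by omega⟩ : Fin n)]
  · rw [hind, hind]
    simp only
    rw [Nat.sub_add_cancel hpos, if_pos le_rfl, if_neg (by omega), sub_zero, one_smul, roundUp]
  · intro i _ hi
    have hi' : (i : ℕ) ≠ ⌈n * s / T⌉₊ - 1 := fun h => hi (Fin.ext h)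
    rw [hind, hind]
    by_cases h : ⌈n * s / T⌉₊ ≤ i
    · rw [if_pos h, if_pos (by omega), sub_self, zero_smul]
    · rw [if_neg h, if_neg (by omega), sub_self, zero_smul]
  · simp

lemma ae_mem_Ioc_window (T : ℝ) : ∀ᵐ s ∂(window T), s ∈ Set.Ioc 0 T := by
  rw [window, ← restrict_Ioc_eq_restrict_Icc]
  exact ae_restrict_mem measurableSet_Ioc

lemma exists_norm_le_window {E : Type*} [NormedAddCommGroup E] {f : ℝ → E}
    (hf : Continuous f) (T : ℝ) : ∃ C, ∀ s ∈ Set.Icc 0 T, ‖f s‖ ≤ C :=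
  isCompact_Icc.exists_bound_of_continuousOn hf.continuousOn

variable {E : Type*} [NormedAddCommGroup E] {f : ℝ → E}

lemma memLp_path (hf : Continuous f) (T : ℝ) : MemLp f 2 (window T) := by
  obtain ⟨C, hC⟩ := exists_norm_le_window hf T
  exact MemLp.of_bound hf.aestronglyMeasurable C
    ((ae_restrict_mem measurableSet_Icc).mono fun s hs => hC s hs)

lemma memLp_sampledPath (hf : Continuous f) (hT : 0 < T) (n : ℕ) :
    MemLp (fun s => f (roundUp T n s)) 2 (window T) := by
  obtain ⟨C, hC⟩ := exists_norm_le_window hf T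
  exact MemLp.of_bound
    (hf.stronglyMeasurable.comp_measurable (measurable_roundUp T n)).aestronglyMeasurable C
    ((ae_restrict_mem measurableSet_Icc).mono fun s hs => hC _ (roundUp_mem hT hs))

/-- A continuous path on `[0, T]` as an element of `L²([0, T]; E)`. -/
noncomputable def path (hf : Continuous f) (T : ℝ) : Lp E 2 (window T) := (memLp_path hf T).toLp f

/-- The path that holds the values of a continuous path at the points of the grid. -/
noncomputable def sampledPath (hf : Continuous f) (hT : 0 < T) (n : ℕ) : Lp E 2 (window T) :=
  (memLp_sampledPath hf hT n).toLp _

variable [InnerProductSpace ℝ E]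

lemma tendsto_norm_path_sub_sampledPath (hf : Continuous f) (hT : 0 < T) :
    Tendsto (fun n => ‖path hf T - sampledPath hf hT n‖ ^ 2) atTop (𝓝 0) := by
  obtain ⟨C, hC⟩ := exists_norm_le_window hf T
  have hnorm : ∀ n, ‖path hf T - sampledPath hf hT n‖ ^ 2 =
      ∫ s, ‖f s - f (roundUp T n s)‖ ^ 2 ∂(window T) := fun n => by
    rw [← real_inner_self_eq_norm_sq, L2.inner_def]
    refine integral_congr_ae ?_
    filter_upwards [Lp.coeFn_sub (path hf T) (sampledPath hf hT n), (memLp_path hf T).coeFn_toLp,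
      (memLp_sampledPath hf hT n).coeFn_toLp] with s h1 h2 h3
    rw [real_inner_self_eq_norm_sq, h1, Pi.sub_apply, path, sampledPath, h2, h3]
  simp only [hnorm]
  have h0 : ∫ _, (0 : ℝ) ∂(window T) = 0 := integral_zero _ _
  rw [← h0]
  refine tendsto_integral_of_dominated_convergence (fun _ => (C + C) ^ 2) (fun n => ?_)
    (integrable_const _) (fun n => ?_) ?_
  · exact ((hf.aestronglyMeasurable.sub (hf.stronglyMeasurable.comp_measurable
      (measurable_roundUp T n)).aestronglyMeasurable).norm).pow 2
  · filter_upwards [ae_restrict_mem measurableSet_Icc] with s hs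
    rw [Real.norm_of_nonneg (by positivity)]
    gcongr
    exact (norm_sub_le _ _).trans (add_le_add (hC s hs) (hC _ (roundUp_mem hT hs)))
  · filter_upwards [ae_restrict_mem measurableSet_Icc] with s hs
    have h1 : Tendsto (fun n => f (roundUp T n s)) atTop (𝓝 (f s)) :=
      (hf.tendsto s).comp (tendsto_roundUp hT hs.1)
    have h2 := ((tendsto_const_nhds (x := f s)).sub h1).norm.pow 2
    simpa using h2

/-- Integrating against a sampled path is a linear function of the samples. -/
lemma exists_kernelOp_sampledPath_eq [CompleteSpace E] (hf : Continuous f) (hT : 0 < T)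
    (hn : 0 < n) (u : Lp ℝ 2 (window T)) :
    ∃ α : Fin n → ℝ, kernelOp (sampledPath hf hT n) u = ∑ i, α i • f (grid T n (i + 1)) := by
  let g : Fin n → ℝ → ℝ := fun i s =>
    u s * ((Set.Icc 0 (grid T n (i + 1))).indicator (fun _ => (1 : ℝ)) s
      - (Set.Icc 0 (grid T n i)).indicator (fun _ => (1 : ℝ)) s)
  have hg : ∀ i, Integrable (g i) (window T) := fun i => by
    have hu : Integrable u (window T) := (Lp.memLp u).integrable (by norm_num)
    refine hu.mul_bdd (c := 2) (by fun_prop (disch := measurability)) (ae_of_all _ fun s => ?_)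
    simp only [Set.indicator_apply]
    split_ifs <;> norm_num
  refine ⟨fun i => ∫ s, g i s ∂(window T), ?_⟩
  rw [kernelOp_apply]
  simp only [← integral_smul_const]
  rw [← integral_finsetSum _ fun i _ => (hg i).smul_const _]
  refine integral_congr_ae ?_
  filter_upwards [(memLp_sampledPath hf hT n).coeFn_toLp, ae_mem_Ioc_window T] with s h1 h2
  rw [sampledPath, h1, comp_roundUp_eq_sum hT hn f h2, Finset.smul_sum]
  simp only [g, mul_smul]

/-- A sampled real path is spanned by the indicators of the segments up to the sampling points. -/
lemma sampledPath_mem_span {f : ℝ → ℝ} (hf : Continuous f) (hT : 0 < T) (hn : 0 < n) :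
    sampledPath hf hT n ∈
      Submodule.span ℝ (Set.range fun i : Fin n => initialIndicator T (grid T n (i + 1))) := by
  have hmem : ∀ i : ℕ, i ≤ n → initialIndicator T (grid T n i) ∈
      Submodule.span ℝ (Set.range fun i : Fin n => initialIndicator T (grid T n (i + 1))) := by
    rintro (_ | i) hi
    · rw [grid_zero, initialIndicator_zero]
      exact Submodule.zero_mem _
    · exact Submodule.subset_span ⟨⟨i, hi⟩, rfl⟩
  have heq : sampledPath hf hT n = ∑ i : Fin n, f (grid T n (i + 1)) •
      (initialIndicator T (grid T n (i + 1)) - initialIndicator T (grid T n i)) := by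
    apply Lp.ext
    have h3 : ∀ᵐ s ∂(window T), ∀ i : Fin n,
        (initialIndicator T (grid T n (i + 1)) - initialIndicator T (grid T n i)) s =
        (Set.Icc 0 (grid T n (i + 1))).indicator (fun _ => (1 : ℝ)) s
          - (Set.Icc 0 (grid T n i)).indicator (fun _ => (1 : ℝ)) s := by
      refine ae_all_iff.2 fun i => ?_
      filter_upwards [Lp.coeFn_sub (initialIndicator T (grid T n (i + 1)))
        (initialIndicator T (grid T n i)), initialIndicator_coeFn T (grid T n (i + 1)),
        initialIndicator_coeFn T (grid T n i)] with s h1 h2 h3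
      rw [h1, Pi.sub_apply, h2, h3]
    filter_upwards [(memLp_sampledPath hf hT n).coeFn_toLp, ae_mem_Ioc_window T, h3,
      coeFn_sum_smul Finset.univ (fun i : Fin n => f (grid T n (i + 1)))
        (fun i : Fin n => initialIndicator T (grid T n (i + 1)) - initialIndicator T (grid T n i))]
      with s h1 h2 h3 h4
    rw [sampledPath, h1, h4, comp_roundUp_eq_sum hT hn f h2]
    refine Finset.sum_congr rfl fun i _ => ?_
    rw [h3, smul_eq_mul, mul_comm]
  rw [heq]
  exact Submodule.sum_mem _ fun i _ => Submodule.smul_mem _ _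
    (Submodule.sub_mem _ (hmem _ i.2) (hmem _ i.2.le))

end Sampling

/-! ### The process as a curve in `L²(P)` -/

section Curve

variable {Ω : Type*} [MeasurableSpace Ω] {P : Measure Ω}

/-- The variables of a Gaussian process as elements of `L²(P)`. -/
noncomputable def toL2 {τ : Type*} {Z : τ → Ω → ℝ} (hZ : IsGaussianProcess Z P) (t : τ) :
    Lp ℝ 2 P :=
  (hZ.hasGaussianLaw_eval t).memLp_two.toLp (Z t)

lemma toL2_coeFn {τ : Type*} {Z : τ → Ω → ℝ} (hZ : IsGaussianProcess Z P) (t : τ) :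
    toL2 hZ t =ᵐ[P] Z t :=
  MemLp.coeFn_toLp _

lemma inner_toL2 {τ : Type*} {Z : τ → Ω → ℝ} (hZ : IsGaussianProcess Z P) (s t : τ) :
    inner ℝ (toL2 hZ s) (toL2 hZ t) = ∫ ω, Z s ω * Z t ω ∂P := by
  rw [inner_eq_integral_mul]
  refine integral_congr_ae ?_
  filter_upwards [toL2_coeFn hZ s, toL2_coeFn hZ t] with ω h1 h2
  rw [h1, h2]

variable {X : ℝ → Ω → ℝ}

lemma inner_toL2_eq_autocorr (hX : IsGaussianProcess X P) (s t : ℝ) :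
    inner ℝ (toL2 hX s) (toL2 hX t) = autocorr P X s t :=
  inner_toL2 hX s t

/-- A process with continuous autocorrelation is mean-square continuous. -/
lemma continuous_toL2 (hX : IsGaussianProcess X P)
    (hR : Continuous (Function.uncurry (autocorr P X))) : Continuous (toL2 hX) := by
  rw [continuous_iff_continuousAt]
  intro t
  rw [ContinuousAt, tendsto_iff_norm_sub_tendsto_zero]
  have hsq : ∀ s, ‖toL2 hX s - toL2 hX t‖ ^ 2 =
      autocorr P X s s - 2 * autocorr P X s t + autocorr P X t t := fun s => by
    rw [norm_sub_sq_real, ← real_inner_self_eq_norm_sq, ← real_inner_self_eq_norm_sq,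
      inner_toL2_eq_autocorr, inner_toL2_eq_autocorr, inner_toL2_eq_autocorr]
  have h1 : Continuous fun s =>
      autocorr P X s s - 2 * autocorr P X s t + autocorr P X t t := by
    have h2 : Continuous fun s => autocorr P X s s := hR.comp (continuous_id.prodMk continuous_id)
    have h3 : Continuous fun s => autocorr P X s t :=
      hR.comp (continuous_id.prodMk continuous_const)
    fun_prop
  have h4 := h1.tendsto t
  rw [show autocorr P X t t - 2 * autocorr P X t t + autocorr P X t t = 0 by ring] at h4
  simp only [← hsq] at h4
  have h5 := h4.sqrt
  simpa only [Real.sqrt_sq (norm_nonneg _), Real.sqrt_zero] using h5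

/-- The factor `u ↦ ∫ u(t) X(t) dt` from `L²([0, T])` to `L²(P)` of the integral operator with
kernel the autocorrelation. -/
noncomputable def processOp (hX : IsGaussianProcess X P)
    (hR : Continuous (Function.uncurry (autocorr P X))) (T : ℝ) :
    Lp ℝ 2 (window T) →L[ℝ] Lp ℝ 2 P :=
  kernelOp (path (continuous_toL2 hX hR) T)

lemma inner_processOp (hX : IsGaussianProcess X P)
    (hR : Continuous (Function.uncurry (autocorr P X))) (T : ℝ) (u : Lp ℝ 2 (window T))
    (c : Lp ℝ 2 P) :
    inner ℝ c (processOp hX hR T u) = ∫ t, u t * inner ℝ c (toL2 hX t) ∂(window T) := by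
  rw [processOp, inner_kernelOp]
  refine integral_congr_ae ?_
  filter_upwards [(memLp_path (continuous_toL2 hX hR) T).coeFn_toLp] with t ht
  rw [path, ht]

lemma processOp_initialIndicator (hX : IsGaussianProcess X P)
    (hR : Continuous (Function.uncurry (autocorr P X))) {T t : ℝ} (ht : t ∈ Set.Icc 0 T)
    (c : Lp ℝ 2 P) :
    inner ℝ c (processOp hX hR T (initialIndicator T t)) =
      ∫ s in Set.Icc 0 t, inner ℝ c (toL2 hX s) := by
  rw [inner_processOp]
  have h : (fun s => initialIndicator T t s * inner ℝ c (toL2 hX s)) =ᵐ[window T]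
      (Set.Icc 0 t).indicator fun s => inner ℝ c (toL2 hX s) := by
    filter_upwards [initialIndicator_coeFn T t] with s hs
    rw [hs]
    by_cases h : s ∈ Set.Icc 0 t <;> simp [h]
  rw [integral_congr_ae h, integral_indicator measurableSet_Icc, window,
    Measure.restrict_restrict measurableSet_Icc,
    Set.inter_eq_left.2 (Set.Icc_subset_Icc_right ht.2)]

lemma integrable_uncurry_window [IsProbabilityMeasure P]
    (hXmeas : Measurable (Function.uncurry X)) (hX : IsGaussianProcess X P)
    (hR : Continuous (Function.uncurry (autocorr P X))) (t : ℝ) :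
    Integrable (Function.uncurry X) ((window t).prod P) := by
  rw [integrable_prod_iff hXmeas.aestronglyMeasurable]
  refine ⟨ae_of_all _ fun s => (hX.hasGaussianLaw_eval s).integrable, ?_⟩
  obtain ⟨C, hC⟩ := exists_norm_le_window (continuous_toL2 hX hR) t
  refine Integrable.of_bound ?_ C ?_
  · exact hXmeas.norm.stronglyMeasurable.integral_prod_right.aestronglyMeasurable
  · filter_upwards [ae_restrict_mem measurableSet_Icc] with s hs
    rw [Real.norm_of_nonneg (integral_nonneg fun _ => norm_nonneg _)]
    refine le_trans (le_of_eq ?_) ((integral_abs_le_norm (toL2 hX s)).trans (hC s hs))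
    refine integral_congr_ae ?_
    filter_upwards [toL2_coeFn hX s] with ω hω
    rw [hω]
    rfl

/-- The mean-square integral of the process agrees with the pathwise integral. -/
lemma processOp_initialIndicator_coeFn [IsProbabilityMeasure P]
    (hXmeas : Measurable (Function.uncurry X)) (hX : IsGaussianProcess X P)
    (hR : Continuous (Function.uncurry (autocorr P X))) {T t : ℝ} (ht : t ∈ Set.Icc 0 T) :
    processOp hX hR T (initialIndicator T t) =ᵐ[P] fun ω => ∫ s in (0 : ℝ)..t, X s ω := by
  have hint := integrable_uncurry_window hXmeas hX hR t
  have hiv : ∀ ω, ∫ s in (0 : ℝ)..t, X s ω = ∫ s, X s ω ∂(window t) := fun ω => by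
    rw [intervalIntegral.integral_of_le ht.1, window, integral_Icc_eq_integral_Ioc]
  simp only [hiv]
  refine Integrable.ae_eq_of_forall_setIntegral_eq _ _ ((Lp.memLp _).integrable (by norm_num))
    hint.integral_prod_right fun B hB _ => ?_
  have h1 : ∀ f : Lp ℝ 2 P, ∫ ω in B, f ω ∂P =
      inner ℝ (indicatorConstLp 2 hB (measure_ne_top P B) (1 : ℝ)) f := fun f => by
    rw [L2.inner_indicatorConstLp_one]
  rw [h1, processOp_initialIndicator hX hR ht, integral_integral_swap]
  · refine integral_congr_ae (ae_of_all _ fun s => ?_)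
    simp only
    rw [← h1]
    exact setIntegral_congr_ae₀ hB.nullMeasurableSet
      ((toL2_coeFn hX s).mono fun ω hω _ => hω)
  · have := hint.swap
    refine this.mono_measure ?_
    exact Measure.prod_mono Measure.restrict_le_self le_rfl

end Curve

/-! ### The Mercer eigenpairs -/

section Mercer

variable {Ω : Type*} [MeasurableSpace Ω] {P : Measure Ω} {X : ℝ → Ω → ℝ} {T : ℝ}
  {ι : Type*} {ev : ι → ℝ} {φ : ι → ℝ → ℝ}

/-- The Mercer eigenfunctions as elements of `L²([0, T])`. -/
noncomputable def eigenvector {R : ℝ → ℝ → ℝ} (hφ : IsMercerSystem R T ev φ) (k : ι) :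
    Lp ℝ 2 (window T) :=
  (hφ.memLp k).toLp (φ k)

lemma eigenvector_coeFn {R : ℝ → ℝ → ℝ} (hφ : IsMercerSystem R T ev φ) (k : ι) :
    eigenvector hφ k =ᵐ[window T] φ k :=
  MemLp.coeFn_toLp _

lemma intervalIntegral_eq_window (hT : 0 < T) (f : ℝ → ℝ) :
    ∫ s in (0 : ℝ)..T, f s = ∫ s, f s ∂(window T) := by
  rw [intervalIntegral.integral_of_le hT.le, window, integral_Icc_eq_integral_Ioc]

lemma orthonormal_eigenvector {R : ℝ → ℝ → ℝ} (hT : 0 < T) (hφ : IsMercerSystem R T ev φ) :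
    Orthonormal ℝ (eigenvector hφ) := by
  classical
  rw [orthonormal_iff_ite]
  intro i j
  have h : inner ℝ (eigenvector hφ i) (eigenvector hφ j) = ∫ t in (0 : ℝ)..T, φ i t * φ j t := by
    rw [inner_eq_integral_mul, intervalIntegral_eq_window hT]
    refine integral_congr_ae ?_
    filter_upwards [eigenvector_coeFn hφ i, eigenvector_coeFn hφ j] with t h1 h2
    rw [h1, h2]
  rw [h]
  split_ifs with hij
  · rw [← hij, hφ.norm_one]
  · exact hφ.orthogonal i j hij

lemma inner_toL2_processOp (hX : IsGaussianProcess X P)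
    (hR : Continuous (Function.uncurry (autocorr P X))) (hT : 0 < T) {u : Lp ℝ 2 (window T)}
    {ψ : ℝ → ℝ} (hu : u =ᵐ[window T] ψ) (t : ℝ) :
    inner ℝ (toL2 hX t) (processOp hX hR T u) = ∫ s in (0 : ℝ)..T, autocorr P X t s * ψ s := by
  rw [inner_processOp, intervalIntegral_eq_window hT]
  refine integral_congr_ae ?_
  filter_upwards [hu] with s hs
  rw [hs, inner_toL2_eq_autocorr, mul_comm]

lemma inner_processOp_eigenvector (hX : IsGaussianProcess X P)
    (hR : Continuous (Function.uncurry (autocorr P X))) (hT : 0 < T)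
    (hφ : IsMercerSystem (autocorr P X) T ev φ) (k : ι) (v : Lp ℝ 2 (window T)) :
    inner ℝ (processOp hX hR T v) (processOp hX hR T (eigenvector hφ k)) =
      ev k * inner ℝ v (eigenvector hφ k) := by
  rw [real_inner_comm, inner_processOp, inner_eq_integral_mul, ← integral_const_mul]
  refine integral_congr_ae ?_
  filter_upwards [eigenvector_coeFn hφ k, ae_restrict_mem measurableSet_Icc] with t h1 h2
  rw [real_inner_comm, inner_toL2_processOp hX hR hT (eigenvector_coeFn hφ k), h1,
    ← hφ.eigen k t h2]
  ring

/-- Each Mercer eigenfunction agrees on the window with a function continuous on `ℝ`. -/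
lemma eigenvector_eq_path (hX : IsGaussianProcess X P)
    (hR : Continuous (Function.uncurry (autocorr P X))) (hT : 0 < T)
    (hφ : IsMercerSystem (autocorr P X) T ev φ) (k : ι) :
    ∃ (f : ℝ → ℝ) (hf : Continuous f), eigenvector hφ k = path hf T := by
  have hf : Continuous fun t =>
      (ev k)⁻¹ * inner ℝ (toL2 hX t) (processOp hX hR T (eigenvector hφ k)) :=
    continuous_const.mul ((continuous_toL2 hX hR).inner continuous_const)
  refine ⟨_, hf, Lp.ext ?_⟩
  filter_upwards [eigenvector_coeFn hφ k, (memLp_path hf T).coeFn_toLp,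
    ae_restrict_mem measurableSet_Icc] with t h1 h2 h3
  rw [h1, path, h2, inner_toL2_processOp hX hR hT (eigenvector_coeFn hφ k), ← hφ.eigen k t h3,
    inv_mul_cancel_left₀ (hφ.pos k).ne']

/-- Completeness of the Mercer system, for eigenvectors in `L²([0, T])`. -/
lemma eq_zero_of_inner_processOp (hX : IsGaussianProcess X P)
    (hR : Continuous (Function.uncurry (autocorr P X))) (hT : 0 < T)
    (hφ : IsMercerSystem (autocorr P X) T ev φ) {c : ℝ} {u : Lp ℝ 2 (window T)} (hc : 0 < c)
    (hu : ∀ v, inner ℝ (processOp hX hR T v) (processOp hX hR T u) = c * inner ℝ v u)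
    (horth : ∀ k, inner ℝ (eigenvector hφ k) u = 0) : u = 0 := by
  -- The eigenvalue equation gives a representative of `u` that satisfies it at every point.
  have hψ : Continuous fun t => c⁻¹ * inner ℝ (toL2 hX t) (processOp hX hR T u) :=
    continuous_const.mul ((continuous_toL2 hX hR).inner continuous_const)
  set ψ : ℝ → ℝ := fun t => c⁻¹ * inner ℝ (toL2 hX t) (processOp hX hR T u) with hψdef
  have hupath : u = path hψ T := by
    refine ext_inner_left ℝ fun v => ?_
    have h1 : inner ℝ v u = c⁻¹ * inner ℝ (processOp hX hR T v) (processOp hX hR T u) := by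
      rw [hu, inv_mul_cancel_left₀ hc.ne']
    rw [h1, real_inner_comm, inner_processOp, inner_eq_integral_mul, ← integral_const_mul]
    refine integral_congr_ae ?_
    filter_upwards [(memLp_path hψ T).coeFn_toLp] with t ht
    rw [path, ht, hψdef, real_inner_comm]
    ring
  have hae : u =ᵐ[window T] ψ := by
    rw [hupath]
    exact (memLp_path hψ T).coeFn_toLp
  have hzero : ∀ t ∈ Set.Icc 0 T, ψ t = 0 := by
    refine hφ.complete c ψ hc (memLp_path hψ T) (fun t _ => ?_) fun k => ?_
    · rw [← inner_toL2_processOp hX hR hT hae, hψdef]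
      exact mul_inv_cancel_left₀ hc.ne' _
    · rw [intervalIntegral_eq_window hT, ← horth k, inner_eq_integral_mul]
      refine integral_congr_ae ?_
      filter_upwards [eigenvector_coeFn hφ k, hae] with t h1 h2
      rw [h1, h2]
  apply Lp.ext
  filter_upwards [hae, Lp.coeFn_zero ℝ 2 (window T), ae_restrict_mem measurableSet_Icc]
    with t h1 h2 h3
  rw [h1, h2, hzero t h3]
  rfl

/-- The spectral form of Mercer's theorem. -/
lemma hasSum_mercer (hX : IsGaussianProcess X P)
    (hR : Continuous (Function.uncurry (autocorr P X))) (hT : 0 < T)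
    (hφ : IsMercerSystem (autocorr P X) T ev φ) (u : Lp ℝ 2 (window T)) :
    HasSum (fun k => ev k * inner ℝ (eigenvector hφ k) u ^ 2) (‖processOp hX hR T u‖ ^ 2) :=
  hasSum_eigenvalue_mul_inner_sq (isCompactOperator_kernelOp _)
    (heig := inner_processOp_eigenvector hX hR hT hφ)
    (hcomp := fun _ _ hc hu horth => eq_zero_of_inner_processOp hX hR hT hφ hc hu horth)
    (he := orthonormal_eigenvector hT hφ) u

/-- The autocorrelation operator is trace class. -/
lemma summable_eigenvalue (hX : IsGaussianProcess X P)
    (hR : Continuous (Function.uncurry (autocorr P X))) (hT : 0 < T)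
    (hφ : IsMercerSystem (autocorr P X) T ev φ) : Summable ev := by
  refine summable_of_sum_le (c := ‖path (continuous_toL2 hX hR) T‖ ^ 2)
    (fun k => (hφ.pos k).le) fun t => ?_
  refine le_trans (le_of_eq ?_) (sum_norm_kernelOp_sq_le (path (continuous_toL2 hX hR) T)
    (orthonormal_eigenvector hT hφ) t)
  refine Finset.sum_congr rfl fun k _ => ?_
  have h := inner_processOp_eigenvector hX hR hT hφ k (eigenvector hφ k)
  rw [real_inner_self_eq_norm_sq, real_inner_self_eq_norm_sq,
    (orthonormal_eigenvector hT hφ).norm_eq_one, one_pow, mul_one] at h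
  exact h.symm

lemma summable_log_eigenvalue (hX : IsGaussianProcess X P)
    (hR : Continuous (Function.uncurry (autocorr P X))) (hT : 0 < T)
    (hφ : IsMercerSystem (autocorr P X) T ev φ) {c : ℝ} (hc : 0 < c) :
    Summable fun k => Real.log (1 + ev k / c) := by
  refine Summable.of_nonneg_of_le (fun k => Real.log_nonneg ?_) (fun k => ?_)
    ((summable_eigenvalue hX hR hT hφ).div_const c)
  · have := hφ.pos k
    have : 0 ≤ ev k / c := by positivity
    linarith
  · have := hφ.pos k
    have h := Real.log_le_sub_one_of_pos (x := 1 + ev k / c) (by positivity)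
    linarith

end Mercer

/-! ### Reduction of the samples to parallel channels -/

section Whitening

variable {H G : Type*} [NormedAddCommGroup H] [InnerProductSpace ℝ H]
  [NormedAddCommGroup G] [InnerProductSpace ℝ G]

/-- If the noise vectors `g i` have the Gram matrix of the vectors `f i`, up to the factor `σ2`,
then the observations `A (f i) + g i` are linearly equivalent to observations of orthogonal inputs
`A (u j)` in white noise `N j` of variance `σ2`, with `u` an orthonormal basis of the span of `f`.
No linear independence of `f` is needed. -/
lemma exists_whitening {n : ℕ} (A : H →L[ℝ] G) (f : Fin n → H) (g : Fin n → G) {σ2 : ℝ}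
    (hfg : ∀ i j, inner ℝ (g i) (g j) = σ2 * inner ℝ (f i) (f j)) :
    ∃ (m : ℕ) (u : Fin m → H) (N : Fin m → G) (μ : Fin m → ℝ≥0) (C : Fin m → Fin n → ℝ)
      (D : Fin n → Fin m → ℝ), Orthonormal ℝ u ∧
      Submodule.span ℝ (Set.range u) = Submodule.span ℝ (Set.range f) ∧
      (∀ i j, inner ℝ (A (u i)) (A (u j)) = if i = j then (μ i : ℝ) else 0) ∧
      (∀ j, N j ∈ Submodule.span ℝ (Set.range g)) ∧
      (∀ i j, inner ℝ (N i) (N j) = if i = j then σ2 else 0) ∧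
      (∀ j, A (u j) + N j = ∑ i, C j i • (A (f i) + g i)) ∧
      (∀ i, A (f i) + g i = ∑ j, D i j • (A (u j) + N j)) := by
  classical
  let V : Submodule ℝ H := Submodule.span ℝ (Set.range f)
  have : FiniteDimensional ℝ V := FiniteDimensional.span_of_finite ℝ (Set.finite_range f)
  obtain ⟨b, μ, hb⟩ := exists_orthonormalBasis_diagonal V (A : H →ₗ[ℝ] G)
  let Φ : (Fin n → ℝ) →ₗ[ℝ] H := Fintype.linearCombination ℝ f
  let Ψ : (Fin n → ℝ) →ₗ[ℝ] G := Fintype.linearCombination ℝ g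
  have hΦ : ∀ a, Φ a = ∑ i, a i • f i := fun a => Fintype.linearCombination_apply ..
  have hΨ : ∀ a, Ψ a = ∑ i, a i • g i := fun a => Fintype.linearCombination_apply ..
  have hgram : ∀ a b, inner ℝ (Ψ a) (Ψ b) = σ2 * inner ℝ (Φ a) (Φ b) := fun a b => by
    rw [hΦ, hΦ, hΨ, hΨ, sum_inner, sum_inner, Finset.mul_sum]
    refine Finset.sum_congr rfl fun i _ => ?_
    rw [inner_sum, inner_sum, Finset.mul_sum]
    refine Finset.sum_congr rfl fun j _ => ?_
    rw [real_inner_smul_left, real_inner_smul_left, real_inner_smul_right, real_inner_smul_right,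
      hfg]
    ring
  have hC : ∀ j, ∃ c : Fin n → ℝ, Φ c = b j := fun j => by
    obtain ⟨c, hc⟩ := (Submodule.mem_span_range_iff_exists_fun ℝ).1 (b j).2
    exact ⟨c, (hΦ c).trans hc⟩
  choose C hC using hC
  have horth : Orthonormal ℝ fun j => (b j : H) :=
    b.orthonormal.comp_linearIsometry V.subtypeₗᵢ
  have hfV : ∀ i, f i ∈ V := fun i => Submodule.subset_span ⟨i, rfl⟩
  let D : Fin n → Fin (Module.finrank ℝ V) → ℝ := fun i j => b.repr ⟨f i, hfV i⟩ j
  have hD : ∀ i, f i = ∑ j, D i j • (b j : H) := fun i => by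
    have h := congrArg Subtype.val (b.sum_repr ⟨f i, hfV i⟩)
    simp only [Submodule.coe_sum, Submodule.coe_smul] at h
    exact h.symm
  have hsingle : ∀ i, Φ (Pi.single i 1) = f i ∧ Ψ (Pi.single i 1) = g i := fun i => by
    rw [hΦ, hΨ]
    constructor <;> simp [Pi.single_apply]
  have hgN : ∀ i, g i = ∑ j, D i j • Ψ (C j) := fun i => by
    have h1 : Φ (Pi.single i 1 - ∑ j, D i j • C j) = 0 := by
      simp only [map_sub, map_sum, map_smul, hC, (hsingle i).1]
      rw [← hD, sub_self]
    have h2 : Ψ (Pi.single i 1 - ∑ j, D i j • C j) = 0 := by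
      rw [← inner_self_eq_zero (𝕜 := ℝ), hgram, h1, inner_zero_left, mul_zero]
    simp only [map_sub, map_sum, map_smul, (hsingle i).2] at h2
    exact sub_eq_zero.1 h2
  refine ⟨Module.finrank ℝ V, fun j => b j, fun j => Ψ (C j), μ, C, D, horth, ?_, hb, fun j => ?_,
    fun i j => ?_, fun j => ?_, fun i => ?_⟩
  · apply le_antisymm
    · rw [Submodule.span_le]
      rintro _ ⟨j, rfl⟩
      exact (b j).2
    · rw [Submodule.span_le]
      rintro _ ⟨i, rfl⟩
      rw [hD i]
      exact Submodule.sum_mem _ fun j _ =>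
        Submodule.smul_mem _ _ (Submodule.subset_span ⟨j, rfl⟩)
  · change Ψ (C j) ∈ _
    rw [hΨ]
    exact Submodule.sum_mem _ fun i _ =>
      Submodule.smul_mem _ _ (Submodule.subset_span ⟨i, rfl⟩)
  · rw [hgram, hC, hC, orthonormal_iff_ite.1 horth i j]
    split_ifs <;> simp
  · simp only [smul_add, Finset.sum_add_distrib]
    rw [← hΨ, ← hC j, hΦ, map_sum]
    simp only [map_smul]
  · simp only [smul_add, Finset.sum_add_distrib]
    rw [← hgN]
    nth_rewrite 1 [hD i]
    rw [map_sum]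
    simp only [map_smul]

lemma inner_eq_zero_of_mem_span {κ : Type*} {g : κ → G} {v N : G} (h : ∀ i, inner ℝ v (g i) = 0)
    (hN : N ∈ Submodule.span ℝ (Set.range g)) : inner ℝ v N = 0 := by
  have hle : Submodule.span ℝ (Set.range g) ≤ (ℝ ∙ v)ᗮ := by
    rw [Submodule.span_le]
    rintro _ ⟨i, rfl⟩
    exact Submodule.mem_orthogonal_singleton_iff_inner_right.2 (h i)
  exact Submodule.mem_orthogonal_singleton_iff_inner_right.1 (hle hN)

end Whitening

section MutualInfo

variable {Ω E F E' F' : Type*} [MeasurableSpace Ω] [MeasurableSpace E] [MeasurableSpace F]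
  [MeasurableSpace E'] [MeasurableSpace F'] {P : Measure Ω}

lemma mutualInfo_congr {U U' : Ω → E} {V V' : Ω → F} (hU : U =ᵐ[P] U') (hV : V =ᵐ[P] V') :
    mutualInfo P U V = mutualInfo P U' V' := by
  have h : (fun ω => (U ω, V ω)) =ᵐ[P] fun ω => (U' ω, V' ω) := by
    filter_upwards [hU, hV] with ω h1 h2
    rw [h1, h2]
  rw [mutualInfo, mutualInfo, Measure.map_congr h, Measure.map_congr hU, Measure.map_congr hV]

/-- Data processing, with the processed variables given almost surely. -/
lemma mutualInfo_le_of_ae_eq [IsProbabilityMeasure P] {U : Ω → E} {V : Ω → F} {U' : Ω → E'}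
    {V' : Ω → F'} (hU : Measurable U) (hV : Measurable V) {f : E → E'} {g : F → F'}
    (hf : Measurable f) (hg : Measurable g) (hU' : U' =ᵐ[P] f ∘ U) (hV' : V' =ᵐ[P] g ∘ V) :
    mutualInfo P U' V' ≤ mutualInfo P U V := by
  rw [mutualInfo_congr hU' hV', mutualInfo, mutualInfo]
  have := Measure.isProbabilityMeasure_map (μ := P) hU.aemeasurable
  have := Measure.isProbabilityMeasure_map (μ := P) hV.aemeasurable
  have := Measure.isProbabilityMeasure_map (μ := P) (hU.prodMk hV).aemeasurable
  have h1 : P.map (fun ω => ((f ∘ U) ω, (g ∘ V) ω)) =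
      (P.map fun ω => (U ω, V ω)).map (Prod.map f g) := by
    rw [Measure.map_map (hf.prodMap hg) (hU.prodMk hV)]
    rfl
  rw [h1, ← Measure.map_map hf hU, ← Measure.map_map hg hV, Measure.map_prod_map _ _ hf hg]
  exact InformationTheory.klDiv_map_le _ _ (hf.prodMap hg)

end MutualInfo

/-! ### Signal and noise as jointly Gaussian variables -/

/-- Two independent Gaussian processes are jointly Gaussian. -/
lemma isGaussianProcess_sumElim {Ω τ τ' : Type*} [MeasurableSpace Ω] {P : Measure Ω}
    {X : τ → Ω → ℝ} {Y : τ' → Ω → ℝ} (hX : IsGaussianProcess X P) (hY : IsGaussianProcess Y P)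
    (hXY : IndepFun (fun ω t => X t ω) (fun ω t => Y t ω) P) :
    IsGaussianProcess (Sum.elim X Y) P where
  hasGaussianLaw I := by
    have hind : IndepFun (fun ω => I.toLeft.restrict (X · ω)) (fun ω => I.toRight.restrict (Y · ω))
        P := hXY.comp (Finset.measurable_restrict I.toLeft) (Finset.measurable_restrict I.toRight)
    have h := IndepFun.hasGaussianLaw (hX.hasGaussianLaw _) (hY.hasGaussianLaw _) hind
    let L : ((I.toLeft → ℝ) × (I.toRight → ℝ)) →L[ℝ] (I → ℝ) := ContinuousLinearMap.pi fun i =>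
      match i with
      | ⟨Sum.inl s, hs⟩ => (ContinuousLinearMap.proj ⟨s, Finset.mem_toLeft.2 hs⟩).comp
          (ContinuousLinearMap.fst ℝ _ _)
      | ⟨Sum.inr s, hs⟩ => (ContinuousLinearMap.proj ⟨s, Finset.mem_toRight.2 hs⟩).comp
          (ContinuousLinearMap.snd ℝ _ _)
    convert h.map_of_measurable L (by fun_prop) using 1
    funext ω i
    rcases i with ⟨s | s, hs⟩ <;> rfl

section Observation

variable {Ω : Type*} [MeasurableSpace Ω] {P : Measure Ω}
  {X : ℝ → Ω → ℝ} {W : ℝ≥0 → Ω → ℝ} {T n₀ : ℝ}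

lemma exists_isGaussianSubspace [IsProbabilityMeasure P]
    (hX : IsStationaryGaussian P X)
    (hR : Continuous (Function.uncurry (autocorr P X))) (T : ℝ) (hW : IsPreBrownianReal W P)
    (hXW : IndepFun (fun ω t => X t ω) (fun ω t => W t ω) P) :
    ∃ S : Submodule ℝ (Lp ℝ 2 P), IsGaussianSubspace P S ∧ (∀ t, toL2 hX.gaussian t ∈ S) ∧
      (∀ t, toL2 hW.isGaussianProcess t ∈ S) ∧ ∀ u, processOp hX.gaussian hR T u ∈ S := by
  have hJ := isGaussianProcess_sumElim hX.gaussian hW.isGaussianProcess hXW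
  have h0 : ∀ t, ∫ ω, Sum.elim X W t ω ∂P = 0 := by
    rintro (t | t)
    · exact hX.zero_mean t
    · exact hW.integral_eval t
  let S₀ : Submodule ℝ (Lp ℝ 2 P) := Submodule.span ℝ (Set.range (toL2 hJ))
  have hmem : ∀ t, toL2 hJ t ∈ S₀ := fun t => Submodule.subset_span ⟨t, rfl⟩
  refine ⟨S₀.topologicalClosure, (isGaussianSubspace_span hJ h0 (toL2_coeFn hJ)).topologicalClosure,
    fun t => S₀.le_topologicalClosure (hmem (Sum.inl t)),
    fun t => S₀.le_topologicalClosure (hmem (Sum.inr t)), fun u => ?_⟩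
  rw [← Submodule.orthogonal_orthogonal_eq_closure, Submodule.mem_orthogonal]
  intro c hc
  rw [inner_processOp]
  refine integral_eq_zero_of_ae (ae_of_all _ fun t => ?_)
  have h : inner ℝ c (toL2 hX.gaussian t) = 0 :=
    (Submodule.mem_orthogonal' _ _).1 hc _ (hmem (Sum.inl t))
  simp [h]

lemma inner_toL2_signal_noise (hX : IsStationaryGaussian P X) (hW : IsPreBrownianReal W P)
    (hXW : IndepFun (fun ω t => X t ω) (fun ω t => W t ω) P) (s : ℝ) (t : ℝ≥0) :
    inner ℝ (toL2 hX.gaussian s) (toL2 hW.isGaussianProcess t) = 0 := by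
  have hind : IndepFun (X s) (W t) P := hXW.comp (measurable_pi_apply s) (measurable_pi_apply t)
  have h : inner ℝ (toL2 hX.gaussian s) (toL2 hW.isGaussianProcess t) = ∫ ω, X s ω * W t ω ∂P := by
    rw [inner_eq_integral_mul]
    refine integral_congr_ae ?_
    filter_upwards [toL2_coeFn hX.gaussian s, toL2_coeFn hW.isGaussianProcess t] with ω h1 h2
    rw [h1, h2]
  rw [h, hind.integral_fun_mul_eq_mul_integral
    (hX.gaussian.hasGaussianLaw_eval s).aemeasurable.aestronglyMeasurable
    (hW.aemeasurable t).aestronglyMeasurable, hX.zero_mean, zero_mul]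

lemma inner_processOp_noise (hX : IsStationaryGaussian P X)
    (hR : Continuous (Function.uncurry (autocorr P X))) (hW : IsPreBrownianReal W P)
    (hXW : IndepFun (fun ω t => X t ω) (fun ω t => W t ω) P) (u : Lp ℝ 2 (window T)) (t : ℝ≥0) :
    inner ℝ (processOp hX.gaussian hR T u) (toL2 hW.isGaussianProcess t) = 0 := by
  rw [real_inner_comm, inner_processOp]
  refine integral_eq_zero_of_ae (ae_of_all _ fun s => ?_)
  have h : inner ℝ (toL2 hW.isGaussianProcess t) (toL2 hX.gaussian s) = 0 := by
    rw [real_inner_comm, inner_toL2_signal_noise hX hW hXW]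
  simp [h]

lemma inner_toL2_noise [IsProbabilityMeasure P] (hW : IsPreBrownianReal W P) (s t : ℝ≥0) :
    inner ℝ (toL2 hW.isGaussianProcess s) (toL2 hW.isGaussianProcess t) = min s t := by
  have hm : ∀ r, MemLp (W r) 2 P := fun r =>
    (hW.isGaussianProcess.hasGaussianLaw_eval r).memLp_two
  rw [inner_toL2, ← hW.covariance_eval s t, covariance_eq_sub (hm s) (hm t), hW.integral_eval]
  simp

/-- The output noise at time `t` as an element of `L²(P)`. -/
noncomputable def noiseL2 (n₀ : ℝ) (hW : IsPreBrownianReal W P) (t : ℝ) : Lp ℝ 2 P :=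
  √(n₀ / 2) • toL2 hW.isGaussianProcess t.toNNReal

/-- Integrated white noise has the Gram matrix of the indicators of the segments `[0, t]`. -/
lemma inner_noiseL2 [IsProbabilityMeasure P] (hn₀ : 0 < n₀) (hW : IsPreBrownianReal W P) {s t : ℝ}
    (hs : s ∈ Set.Icc 0 T) (ht : t ∈ Set.Icc 0 T) :
    inner ℝ (noiseL2 n₀ hW s) (noiseL2 n₀ hW t) =
      n₀ / 2 * inner ℝ (initialIndicator T s) (initialIndicator T t) := by
  rw [inner_initialIndicator hs ht, noiseL2, noiseL2, real_inner_smul_left, real_inner_smul_right,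
    inner_toL2_noise hW, ← mul_assoc, Real.mul_self_sqrt (by positivity), NNReal.coe_min,
    Real.coe_toNNReal _ hs.1, Real.coe_toNNReal _ ht.1]

lemma awgnOutput_ae_eq [IsProbabilityMeasure P]
    (hXmeas : Measurable (Function.uncurry X)) (hX : IsGaussianProcess X P)
    (hR : Continuous (Function.uncurry (autocorr P X))) (hW : IsPreBrownianReal W P) {t : ℝ}
    (ht : t ∈ Set.Icc 0 T) :
    awgnOutput n₀ X W t =ᵐ[P] ⇑(processOp hX hR T (initialIndicator T t) + noiseL2 n₀ hW t) := by
  filter_upwards [Lp.coeFn_add (processOp hX hR T (initialIndicator T t)) (noiseL2 n₀ hW t),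
    processOp_initialIndicator_coeFn hXmeas hX hR ht,
    Lp.coeFn_smul √(n₀ / 2) (toL2 hW.isGaussianProcess t.toNNReal),
    toL2_coeFn hW.isGaussianProcess t.toNNReal] with ω h1 h2 h3 h4
  rw [h1, Pi.add_apply, h2, noiseL2, h3, Pi.smul_apply, h4, smul_eq_mul, awgnOutput]

lemma sampleMutualInfo_eq [IsProbabilityMeasure P]
    (hXmeas : Measurable (Function.uncurry X)) (hX : IsGaussianProcess X P)
    (hR : Continuous (Function.uncurry (autocorr P X))) (hW : IsPreBrownianReal W P) {n : ℕ}
    {t : Fin n → ℝ} (ht : ∀ i, t i ∈ Set.Icc 0 T) :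
    sampleMutualInfo P X (awgnOutput n₀ X W) t = mutualInfo P (fun ω i => toL2 hX (t i) ω)
      fun ω i => (processOp hX hR T (initialIndicator T (t i)) + noiseL2 n₀ hW (t i)) ω := by
  refine mutualInfo_congr ?_ ?_
  · filter_upwards [ae_all_iff.2 fun i => toL2_coeFn hX (t i)] with ω hω
    exact funext fun i => (hω i).symm
  · filter_upwards [ae_all_iff.2 fun i =>
      awgnOutput_ae_eq (n₀ := n₀) hXmeas hX hR hW (ht i)] with ω hω
    exact funext hω

/-- The whitened channel behind the samples at the instants `t i`: the outputs at these instants are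
linearly equivalent to the outputs of parallel channels with inputs `processOp (u j)`, for an
orthonormal basis `u` of the span of the indicators of the segments `[0, t i]`. The side information
is any family of variables of the signal. -/
lemma exists_isParallelChannel [IsProbabilityMeasure P]
    (hX : IsStationaryGaussian P X)
    (hR : Continuous (Function.uncurry (autocorr P X))) (hn₀ : 0 < n₀)
    (hW : IsPreBrownianReal W P) (hXW : IndepFun (fun ω t => X t ω) (fun ω t => W t ω) P)
    {n : ℕ} {t : Fin n → ℝ} (ht : ∀ i, t i ∈ Set.Icc 0 T) :
    ∃ (m : ℕ) (u : Fin m → Lp ℝ 2 (window T)) (N : Fin m → Lp ℝ 2 P) (μ : Fin m → ℝ≥0)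
      (C : Fin m → Fin n → ℝ) (D : Fin n → Fin m → ℝ) (S : Submodule ℝ (Lp ℝ 2 P)),
      Orthonormal ℝ u ∧
      Submodule.span ℝ (Set.range u) =
        Submodule.span ℝ (Set.range fun i => initialIndicator T (t i)) ∧
      IsParallelChannel S (Sum.elim (fun i => toL2 hX.gaussian (t i))
        fun j => processOp hX.gaussian hR T (u j)) (fun j => processOp hX.gaussian hR T (u j)) N μ
        (n₀ / 2).toNNReal ∧
      (∀ j, processOp hX.gaussian hR T (u j) + N j = ∑ i, C j i •
        (processOp hX.gaussian hR T (initialIndicator T (t i)) + noiseL2 n₀ hW (t i))) ∧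
      (∀ i, processOp hX.gaussian hR T (initialIndicator T (t i)) + noiseL2 n₀ hW (t i) =
        ∑ j, D i j • (processOp hX.gaussian hR T (u j) + N j)) := by
  obtain ⟨S, hS, hSX, hSW, hSA⟩ := exists_isGaussianSubspace hX hR T hW hXW
  obtain ⟨m, u, N, μ, C, D, hu, hspan, hμ, hN, hNN, hC, hD⟩ :=
    exists_whitening (processOp hX.gaussian hR T) (fun i => initialIndicator T (t i))
      (fun i => noiseL2 n₀ hW (t i)) (σ2 := n₀ / 2)
      fun i j => inner_noiseL2 hn₀ hW (ht i) (ht j)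
  have hAN : ∀ i j, inner ℝ (processOp hX.gaussian hR T (u i)) (N j) = 0 := fun i j => by
    refine inner_eq_zero_of_mem_span (fun k => ?_) (hN j)
    rw [noiseL2, real_inner_smul_right, inner_processOp_noise hX hR hW hXW, mul_zero]
  refine ⟨m, u, N, μ, C, D, S, hu, hspan, ?_, hC, hD⟩
  exact
    { gaussian := hS
      mem_side := by
        rintro (i | j)
        · exact hSX _
        · exact hSA _
      mem_input := fun j => hSA _
      mem_noise := fun j => by
        refine Submodule.span_le.2 ?_ (hN j)
        rintro _ ⟨i, rfl⟩
        exact S.smul_mem _ (hSW _)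
      noise_pos := (Real.toNNReal_pos.2 (by positivity)).ne'
      inner_side_noise := by
        rintro (i | i) j
        · refine inner_eq_zero_of_mem_span (fun k => ?_) (hN j)
          rw [Sum.elim_inl, noiseL2, real_inner_smul_right, inner_toL2_signal_noise hX hW hXW,
            mul_zero]
        · exact hAN i j
      inner_input_noise := hAN
      inner_input := hμ
      inner_noise := fun i j => by rw [hNN, Real.coe_toNNReal _ (by positivity)] }

lemma IsParallelChannel.of_sumElim {κ κ' : Type*} {m : ℕ} {S : Submodule ℝ (Lp ℝ 2 P)}
    {U : κ → Lp ℝ 2 P} {U' : κ' → Lp ℝ 2 P} {s N : Fin m → Lp ℝ 2 P} {μ : Fin m → ℝ≥0} {σ2 : ℝ≥0}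
    (h : IsParallelChannel S (Sum.elim U U') s N μ σ2) : IsParallelChannel S U s N μ σ2 :=
  { h with
    mem_side := fun k => h.mem_side (Sum.inl k)
    inner_side_noise := fun k => h.inner_side_noise (Sum.inl k) }

lemma measurable_coeFn_pi {κ : Type*} (f : κ → Lp ℝ 2 P) : Measurable fun ω k => f k ω :=
  measurable_pi_lambda _ fun k => measurable_coeFn (f k)

lemma coeFn_pi_eq_sum {κ : Type*} [Fintype κ] {m : ℕ} {z : Fin m → Lp ℝ 2 P} {y : κ → Lp ℝ 2 P}
    {C : Fin m → κ → ℝ} (h : ∀ j, z j = ∑ k, C j k • y k) :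
    (fun ω j => z j ω) =ᵐ[P] (fun v j => ∑ k, C j k * v k) ∘ fun ω k => y k ω := by
  filter_upwards [ae_all_iff.2 fun j => coeFn_sum_smul Finset.univ (C j) y] with ω hω
  funext j
  rw [h j, hω j]
  rfl

/-! ### Bounds for the information in the samples -/

variable {ι : Type*} {ev : ι → ℝ} {φ : ι → ℝ → ℝ}

/-- Samples at any instants carry at most the claimed information: adding the inputs of the whitened
channel to the signal samples can only increase the information, and makes it computable. -/
lemma sampleMutualInfo_le [IsProbabilityMeasure P] (hXmeas : Measurable (Function.uncurry X))
    (hX : IsStationaryGaussian P X) (hR : Continuous (Function.uncurry (autocorr P X)))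
    (hT : 0 < T) (hn₀ : 0 < n₀) (hW : IsPreBrownianReal W P)
    (hXW : IndepFun (fun ω t => X t ω) (fun ω t => W t ω) P)
    (hφ : IsMercerSystem (autocorr P X) T ev φ) {n : ℕ} {t : Fin n → ℝ}
    (ht : ∀ i, t i ∈ Set.Icc 0 T) :
    sampleMutualInfo P X (awgnOutput n₀ X W) t ≤
      ENNReal.ofReal (1 / 2 * ∑' k, Real.log (1 + ev k / (n₀ / 2))) := by
  classical
  have hc : 0 < n₀ / 2 := by positivity
  obtain ⟨m, u, N, μ, C, D, S, hu, -, hch, -, hD⟩ :=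
    exists_isParallelChannel hX hR hn₀ hW hXW ht
  have hinfo := hch.klDiv_eq (fun j => Pi.single (Sum.inr j) 1) fun j => by
    simp [Pi.single_apply]
  rw [Real.coe_toNNReal _ hc.le] at hinfo
  rw [sampleMutualInfo_eq hXmeas hX.gaussian hR hW ht]
  refine (mutualInfo_le_of_ae_eq (f := fun v i => v (Sum.inl i))
    (g := fun v i => ∑ j, D i j * v j) (measurable_coeFn_pi _) (measurable_coeFn_pi _)
    (by fun_prop) (by fun_prop) ?_ (coeFn_pi_eq_sum hD)).trans (hinfo.le.trans ?_)
  · exact EventuallyEq.rfl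
  · refine ENNReal.ofReal_le_ofReal ?_
    have := sum_log_compression_le (orthonormal_eigenvector hT hφ).norm_eq_one hφ.pos
      (hasSum_mercer hX.gaussian hR hT hφ) hc (summable_log_eigenvalue hX.gaussian hR hT hφ hc) hu
      hch.inner_input
    linarith

/-- Samples on a uniform grid carry nearly the claimed information. There are two losses: the
channel inputs are estimated from finitely many samples of the signal, and the eigenfunctions are
approximated by step functions. -/
lemma le_sampleMutualInfo_grid [IsProbabilityMeasure P] (hXmeas : Measurable (Function.uncurry X))
    (hX : IsStationaryGaussian P X) (hR : Continuous (Function.uncurry (autocorr P X)))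
    (hT : 0 < T) (hn₀ : 0 < n₀) (hW : IsPreBrownianReal W P)
    (hXW : IndepFun (fun ω t => X t ω) (fun ω t => W t ω) P)
    (hφ : IsMercerSystem (autocorr P X) T ev φ) {f : ι → ℝ → ℝ} (hf : ∀ k, Continuous (f k))
    (hfe : ∀ k, eigenvector hφ k = path (hf k) T) (F : Finset ι) {n : ℕ} (hn : 0 < n) :
    ENNReal.ofReal (1 / 2 * ∑ k ∈ F, (1 - ‖path (hf k) T - sampledPath (hf k) hT n‖ ^ 2) *
        Real.log (1 + ev k / (n₀ / 2)) - ‖path (continuous_toL2 hX.gaussian hR) T -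
          sampledPath (continuous_toL2 hX.gaussian hR) hT n‖ ^ 2 / n₀) ≤
      sampleMutualInfo P X (awgnOutput n₀ X W) fun i : Fin n => grid T n (i + 1) := by
  have hc : 0 < n₀ / 2 := by positivity
  have ht : ∀ i : Fin n, grid T n (i + 1) ∈ Set.Icc 0 T := fun i => grid_mem hT i.2
  have hx := continuous_toL2 hX.gaussian hR
  obtain ⟨m, u, N, μ, C, D, S, hu, hspan, hch, hC, -⟩ :=
    exists_isParallelChannel hX hR hn₀ hW hXW ht
  choose α hα using fun j => exists_kernelOp_sampledPath_eq hx hT hn (u j)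
  have hinfo := hch.of_sumElim.le_klDiv α
  rw [Real.coe_toNNReal _ hc.le, mul_div_cancel₀ _ two_ne_zero] at hinfo
  rw [sampleMutualInfo_eq hXmeas hX.gaussian hR hW ht]
  refine le_trans (le_trans (ENNReal.ofReal_le_ofReal ?_) hinfo)
    (mutualInfo_le_of_ae_eq (f := id) (g := fun v j => ∑ i, C j i * v i) (measurable_coeFn_pi _)
      (measurable_coeFn_pi _) measurable_id (by fun_prop) EventuallyEq.rfl (coeFn_pi_eq_sum hC))
  have hest : ∑ j, ‖processOp hX.gaussian hR T (u j) -
      ∑ i, α j i • toL2 hX.gaussian (grid T n (i + 1))‖ ^ 2 ≤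
      ‖path hx T - sampledPath hx hT n‖ ^ 2 := by
    refine le_trans (le_of_eq ?_) (sum_norm_kernelOp_sq_le (path hx T - sampledPath hx hT n) hu
      Finset.univ)
    refine Finset.sum_congr rfl fun j _ => ?_
    rw [← hα, map_sub, sub_apply, processOp]
  have hproj : ∀ k, 1 - ‖path (hf k) T - sampledPath (hf k) hT n‖ ^ 2 ≤
      ∑ j, inner ℝ (eigenvector hφ k) (u j) ^ 2 := fun k => by
    rw [← hfe]
    refine one_sub_norm_sub_sq_le hu ((orthonormal_eigenvector hT hφ).norm_eq_one k) ?_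
    rw [hspan]
    exact sampledPath_mem_span (hf k) hT hn
  have hlog : ∀ k, 0 ≤ Real.log (1 + ev k / (n₀ / 2)) := fun k =>
    Real.log_nonneg (le_add_of_nonneg_right (div_nonneg (hφ.pos k).le hc.le))
  have hcomp := sum_mul_log_eigenvalue_le (orthonormal_eigenvector hT hφ) hφ.pos
    (hasSum_mercer hX.gaussian hR hT hφ) hc F hu.norm_eq_one
  have hμ : ∀ j, ‖processOp hX.gaussian hR T (u j)‖ ^ 2 = μ j := fun j => by
    rw [← real_inner_self_eq_norm_sq, hch.inner_input, if_pos rfl]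
  simp only [hμ] at hcomp
  have hsum : ∑ k ∈ F, (1 - ‖path (hf k) T - sampledPath (hf k) hT n‖ ^ 2) *
      Real.log (1 + ev k / (n₀ / 2)) ≤ ∑ j, Real.log (1 + μ j / (n₀ / 2)) :=
    (Finset.sum_le_sum fun k _ => mul_le_mul_of_nonneg_right (hproj k) (hlog k)).trans hcomp
  have hest' := div_le_div_of_nonneg_right hest hn₀.le
  linarith

end Observation

end FiniteTimeMI

theorem theorem1 {Ω : Type*} [MeasurableSpace Ω] (P : Measure Ω) [IsProbabilityMeasure P]
    (X : ℝ → Ω → ℝ) (W : ℝ≥0 → Ω → ℝ) (T n₀ : ℝ) (hT : 0 < T) (hn₀ : 0 < n₀)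
    (hXmeas : Measurable (Function.uncurry X))
    (hX : FiniteTimeMI.IsStationaryGaussian P X)
    (hR : Continuous (Function.uncurry (FiniteTimeMI.autocorr P X)))
    (hW : IsPreBrownianReal W P)
    (hXW : IndepFun (fun ω t => X t ω) (fun ω t => W t ω) P)
    {ι : Type*} (ev : ι → ℝ) (φ : ι → ℝ → ℝ)
    (hφ : FiniteTimeMI.IsMercerSystem (FiniteTimeMI.autocorr P X) T ev φ) :
    Summable (fun k => Real.log (1 + ev k / (n₀ / 2))) ∧
      FiniteTimeMI.IsFiniteTimeMutualInfo P X (FiniteTimeMI.awgnOutput n₀ X W) T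
        (ENNReal.ofReal (1 / 2 * ∑' k, Real.log (1 + ev k / (n₀ / 2)))) := by
  open FiniteTimeMI in
  have hsum : Summable fun k => Real.log (1 + ev k / (n₀ / 2)) :=
    summable_log_eigenvalue hX.gaussian hR hT hφ (by positivity)
  refine ⟨hsum, tendsto_order.2 ⟨fun a ha => ?_, fun b hb => Eventually.of_forall fun n => ?_⟩⟩
  · choose f hf hfe using eigenvector_eq_path hX.gaussian hR hT hφ
    have hF : Tendsto (fun F : Finset ι => ENNReal.ofReal (1 / 2 * ∑ k ∈ F,
        Real.log (1 + ev k / (n₀ / 2)))) atTop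
        (𝓝 (ENNReal.ofReal (1 / 2 * ∑' k, Real.log (1 + ev k / (n₀ / 2))))) :=
      (ENNReal.continuous_ofReal.tendsto _).comp (Tendsto.const_mul (1 / 2 : ℝ) hsum.hasSum)
    -- A finite part of the series already exceeds `a`; on fine grids so do the samples.
    obtain ⟨F, hFa⟩ := (hF.eventually (lt_mem_nhds ha)).exists
    have hlim : Tendsto (fun n => ENNReal.ofReal (1 / 2 * ∑ k ∈ F,
        (1 - ‖path (hf k) T - sampledPath (hf k) hT n‖ ^ 2) * Real.log (1 + ev k / (n₀ / 2)) -
          ‖path (continuous_toL2 hX.gaussian hR) T -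
            sampledPath (continuous_toL2 hX.gaussian hR) hT n‖ ^ 2 / n₀)) atTop
        (𝓝 (ENNReal.ofReal (1 / 2 * ∑ k ∈ F, (1 - 0) * Real.log (1 + ev k / (n₀ / 2)) -
          0 / n₀))) :=
      (ENNReal.continuous_ofReal.tendsto _).comp <|
        ((tendsto_finsetSum F fun k _ => (tendsto_const_nhds.sub
          (tendsto_norm_path_sub_sampledPath (hf k) hT)).mul_const _).const_mul _).sub
          ((tendsto_norm_path_sub_sampledPath _ hT).div_const n₀)
    simp only [sub_zero, one_mul, zero_div] at hlim
    filter_upwards [hlim.eventually (lt_mem_nhds hFa), eventually_gt_atTop 0] with n hn hn0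
    refine hn.trans_le ((le_sampleMutualInfo_grid hXmeas hX hR hT hn₀ hW hXW hφ hf hfe F hn0).trans
      (le_iSup (fun t : Fin n → Set.Icc (0 : ℝ) T =>
        sampleMutualInfo P X (awgnOutput n₀ X W) fun i => (t i : ℝ)) fun i => ⟨_, grid_mem hT i.2⟩))
  -- The upper bound holds for every number of samples, not only in the limit.
  · exact (iSup_le fun t =>
      sampleMutualInfo_le hXmeas hX hR hT hn₀ hW hXW hφ fun i => (t i).2).trans_lt hb
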